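/- **Setting.** Consider the system $x(t+1)=Ax(t)+Bu(t)+w(t)$, $y(t)=Cx(t)+v(t)$, $t\ge 0$, with $x(t)\in\mathbb R^n$, $u(t)\in\mathbb R^m$, $y(t)\in\mathbb R^p$, where the initial state and the noises are independent at all times, $x(0)\sim\mathcal N(0,\Sigma_0)$, $w(t)\sim\mathcal N(0,Q_w)$, $v(t)\sim\mathcal N(0,R_v)$, $\Sigma_0\succ0$, $Q_w\succeq0$, $R_v\succ0$. The data consist of $N$ independent experiments of horizon $T$ on this system, with inputs $u^i(s)\sim\mathcal N(0,\Sigma_u)$, $\Sigma_u\succ0$, independent of each other, of the noises and of the initial states; $x^i$, $y^i$ are the resulting state and output trajectories. For $t\in\{0,\dots,T\}$ let $X_t=[x^1(t)\ \cdots\ x^N(t)]$, let $U_{t-1}$ be the matrix whose $i$-th column stacks $u^i(0),\dots,u^i(t-1)$, let $Y_t$ be the matrix whose $i$-th column stacks $y^i(0),\dots,y^i(t)$, and let $$L_t^{\mathrm D}=X_t\begin{bmatrix}U_{t-1}\\ Y_t\end{bmatrix}^{\dagger},$$ with ${}^\dagger$ the Moore–Penrose pseudoinverse. Consider further a run of the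 system, with inputs $u$ and outputs $y$, in which $u(s)$ is a function of $y(0),\dots,y(s)$ and of information that is independent of the initial state and the noise of this run. Write $z_t=[u_0^{t-1};y_0^t]$ for the vector that stacks $u(0),\dots,u(t-1),y(0),\dots,y(t)$, and let $x_{\mathrm{KF}}(t)$ be the Kalman estimate of $x(t)$, i.e. the function of $z_t$ that minimizes the mean square error $\mathbb E\|x(t)-x_{\mathrm{KF}}(t)\|_2^2$. **Theorem 2 (Data-driven Kalman filter).** Let $t\in\{0,\dots,T\}$, $\delta\in(0,1/2]$ and $N\ge 8\big((m+p)t+p\big)+16\log(1/\delta)$. Then, with probability at least $1-2\delta$, $$\left\|x_{\mathrm{KF}}(t)-L_t^{\mathrm D}\begin{bmatrix}u_0^{t-1}\\ y_0^t\end{bmatrix}\right\|_2\le\frac{c_3}{\sqrt N}\left\|\begin{bmatrix}u_0^{t-1}\\ y_0^t\end{bmatrix}\right\|_2,$$ where $$c_3=16\,\|\Sigma_Z^{-1/2}\|_2\,\|\Sigma_{e,t}\|_2^{1/2}\sqrt{\big((m+p)t+n+p\big)\log(9/\delta)}$$ does not depend on $N$. Here $\Sigma_Z\succ0$ is the covariance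 matrix of a column of $[U_{t-1};Y_t]$, and $\Sigma_{e,t}$ is the covariance matrix of the estimation error $x(t)-x_{\mathrm{KF}}(t)$. -/

import Mathlib

open MeasureTheory ProbabilityTheory

set_option linter.unusedSectionVars false

namespace DataKF

/-! ### Matrices -/

section Matrices

open scoped Matrix MatrixOrder Matrix.Norms.L2Operator

variable {r c : Type*} [Fintype r] [DecidableEq r] [Fintype c]

/-- The Moore-Penrose pseudoinverse `Aᵀ (A Aᵀ)⁺` of a real matrix, where `(A Aᵀ)⁺` inverts the
nonzero eigenvalues of the symmetric matrix `A Aᵀ` and keeps its kernel (`0⁻¹ = 0`).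
For a matrix with full row rank this is the right pseudoinverse `Aᵀ (A Aᵀ)⁻¹`. -/
noncomputable def pinv (A : Matrix r c ℝ) : Matrix c r ℝ :=
  Aᵀ * cfc (fun x : ℝ => x⁻¹) (A * Aᵀ)

theorem mul_transpose_isSelfAdjoint (A : Matrix r c ℝ) : IsSelfAdjoint (A * Aᵀ) := by
  rw [IsSelfAdjoint, Matrix.star_eq_conjTranspose, Matrix.conjTranspose_eq_transpose_of_trivial]
  simp [Matrix.transpose_mul]

theorem contOn (M : Matrix r r ℝ) (f : ℝ → ℝ) : ContinuousOn f (spectrum ℝ M) :=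
  (Matrix.finite_real_spectrum (A := M)).continuousOn f

theorem cfc_inv_transpose (A : Matrix r c ℝ) :
    (cfc (fun x : ℝ => x⁻¹) (A * Aᵀ))ᵀ = cfc (fun x : ℝ => x⁻¹) (A * Aᵀ) := by
  have h : IsSelfAdjoint (cfc (fun x : ℝ => x⁻¹) (A * Aᵀ)) := cfc_predicate _ _
  rwa [IsSelfAdjoint, Matrix.star_eq_conjTranspose,
    Matrix.conjTranspose_eq_transpose_of_trivial] at h

theorem gram_mul_inv_mul_gram (A : Matrix r c ℝ) :
    (A * Aᵀ) * cfc (fun x : ℝ => x⁻¹) (A * Aᵀ) * (A * Aᵀ) = A * Aᵀ := by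
  have hs := mul_transpose_isSelfAdjoint A
  have hid : cfc (fun x : ℝ => x) (A * Aᵀ) = A * Aᵀ := cfc_id' ℝ _ hs
  calc _ = cfc (fun x : ℝ => x) (A * Aᵀ) * cfc (fun x : ℝ => x⁻¹) (A * Aᵀ)
          * cfc (fun x : ℝ => x) (A * Aᵀ) := by rw [hid]
    _ = cfc (fun x : ℝ => x * x⁻¹ * x) (A * Aᵀ) := by
        rw [← cfc_mul _ _ _ (contOn _ _) (contOn _ _), ← cfc_mul _ _ _ (contOn _ _) (contOn _ _)]
    _ = A * Aᵀ := by
        simp only [mul_inv_mul_cancel]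
        exact hid

/-- First Penrose equation. -/
theorem mul_pinv_mul (A : Matrix r c ℝ) : A * pinv A * A = A := by
  set G := cfc (fun x : ℝ => x⁻¹) (A * Aᵀ) with hG
  have h := gram_mul_inv_mul_gram A
  rw [← hG] at h
  have hGt : Gᵀ = G := cfc_inv_transpose A
  have h0 : (A * pinv A * A - A) * (A * pinv A * A - A)ᵀ = 0 := by
    have e : A * pinv A * A - A = (A * Aᵀ * G - 1) * A := by
      simp [pinv, ← hG, Matrix.sub_mul, Matrix.mul_assoc]
    rw [e, Matrix.transpose_mul, ← Matrix.mul_assoc, Matrix.mul_assoc _ A Aᵀ, Matrix.sub_mul, h]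
    simp
  rw [← Matrix.conjTranspose_eq_transpose_of_trivial, Matrix.self_mul_conjTranspose_eq_zero] at h0
  exact sub_eq_zero.mp h0

/-- Second Penrose equation. -/
theorem pinv_mul_pinv (A : Matrix r c ℝ) : pinv A * A * pinv A = pinv A := by
  have hs := mul_transpose_isSelfAdjoint A
  have hid : cfc (fun x : ℝ => x) (A * Aᵀ) = A * Aᵀ := cfc_id' ℝ _ hs
  have key : cfc (fun x : ℝ => x⁻¹) (A * Aᵀ) * (A * Aᵀ) * cfc (fun x : ℝ => x⁻¹) (A * Aᵀ)
      = cfc (fun x : ℝ => x⁻¹) (A * Aᵀ) := by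
    calc _ = cfc (fun x : ℝ => x⁻¹) (A * Aᵀ) * cfc (fun x : ℝ => x) (A * Aᵀ)
          * cfc (fun x : ℝ => x⁻¹) (A * Aᵀ) := by rw [hid]
      _ = cfc (fun x : ℝ => x⁻¹ * x * x⁻¹) (A * Aᵀ) := by
        rw [← cfc_mul _ _ _ (contOn _ _) (contOn _ _), ← cfc_mul _ _ _ (contOn _ _) (contOn _ _)]
      _ = _ := by
        congr 1
        funext a
        rcases eq_or_ne a 0 with h | h
        · simp [h]
        · simp [h]
  calc pinv A * A * pinv A = Aᵀ * (cfc (fun x : ℝ => x⁻¹) (A * Aᵀ) * (A * Aᵀ)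
        * cfc (fun x : ℝ => x⁻¹) (A * Aᵀ)) := by simp only [pinv, Matrix.mul_assoc]
    _ = pinv A := by rw [key, pinv]

/-- Third Penrose equation. -/
theorem mul_pinv_symm (A : Matrix r c ℝ) : (A * pinv A)ᵀ = A * pinv A := by
  have hs := mul_transpose_isSelfAdjoint A
  have hcom : Commute (A * Aᵀ) (cfc (fun x : ℝ => x⁻¹) (A * Aᵀ)) := by
    have hid : cfc (fun x : ℝ => x) (A * Aᵀ) = A * Aᵀ := cfc_id' ℝ _ hs
    have := cfc_commute_cfc (fun x : ℝ => x) (fun x : ℝ => x⁻¹) (A * Aᵀ)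
    rwa [hid] at this
  simp only [pinv]
  rw [← Matrix.mul_assoc, Matrix.transpose_mul, cfc_inv_transpose, Matrix.transpose_mul,
    Matrix.transpose_transpose]
  exact hcom.eq.symm

/-- Fourth Penrose equation. -/
theorem pinv_mul_symm (A : Matrix r c ℝ) : (pinv A * A)ᵀ = pinv A * A := by
  simp only [pinv, Matrix.transpose_mul, Matrix.transpose_transpose, cfc_inv_transpose,
    Matrix.mul_assoc]

end Matrices

/-! ### The system and its trajectories -/

/-- The matrices of the system `x(t+1) = A x(t) + B u(t) + w(t)`, `y(t) = C x(t) + v(t)` and the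
covariances of its noises `w(t)`, `v(t)` and of its initial state. -/
structure LinearSystem (n m p : ℕ) where
  A : Matrix (Fin n) (Fin n) ℝ
  B : Matrix (Fin n) (Fin m) ℝ
  C : Matrix (Fin p) (Fin n) ℝ
  Qw : Matrix (Fin n) (Fin n) ℝ
  Rv : Matrix (Fin p) (Fin p) ℝ
  S0 : Matrix (Fin n) (Fin n) ℝ
  Qw_posSemidef : Qw.PosSemidef
  Rv_posDef : Rv.PosDef
  S0_posDef : S0.PosDef

/-- The random variables of one run of the system. -/
structure Trajectory (n m p : ℕ) (Ω : Type*) where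
  x : ℕ → Ω → EuclideanSpace ℝ (Fin n)
  u : ℕ → Ω → EuclideanSpace ℝ (Fin m)
  y : ℕ → Ω → EuclideanSpace ℝ (Fin p)
  w : ℕ → Ω → EuclideanSpace ℝ (Fin n)
  v : ℕ → Ω → EuclideanSpace ℝ (Fin p)

/-- The sources of noise of a run with horizon `T`: the initial state `x(0)`, the process noise
`w(0), …, w(T-1)` and the measurement noise `v(0), …, v(T)`. -/
inductive NoiseSource (T : ℕ) where
  | init
  | process (s : Fin T)
  | measurement (s : Fin (T + 1))

/-- The dimension of a noise source. -/
def NoiseSource.dim (n p : ℕ) {T : ℕ} : NoiseSource T → ℕ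
  | .init => n
  | .process _ => n
  | .measurement _ => p

/-- The dimension of a noise source or (`Sum.inr s`) of the input `u(s)`. -/
def sourceDim (n m p : ℕ) {T : ℕ} : NoiseSource T ⊕ Fin T → ℕ
  | .inl k => k.dim n p
  | .inr _ => m

/-- The indices of the entries of the vector `[u(0); …; u(t-1); y(0); …; y(t)]`. -/
abbrev PastIndex (m p t : ℕ) : Type := (Fin t × Fin m) ⊕ (Fin (t + 1) × Fin p)

section

variable {n m p : ℕ} {Ω : Type*}

/-- The covariance of a noise source. -/
def LinearSystem.noiseCov (S : LinearSystem n m p) {T : ℕ} :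
    (k : NoiseSource T) → Matrix (Fin (k.dim n p)) (Fin (k.dim n p)) ℝ
  | .init => S.S0
  | .process _ => S.Qw
  | .measurement _ => S.Rv

namespace Trajectory

/-- The random vector of a noise source. -/
def noise (τ : Trajectory n m p Ω) {T : ℕ} :
    (k : NoiseSource T) → Ω → EuclideanSpace ℝ (Fin (k.dim n p))
  | .init => τ.x 0
  | .process s => τ.w s
  | .measurement s => τ.v s

/-- The random vector of a noise source or of an input. -/
def source (τ : Trajectory n m p Ω) {T : ℕ} :
    (k : NoiseSource T ⊕ Fin T) → Ω → EuclideanSpace ℝ (Fin (sourceDim n m p k))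
  | .inl k => τ.noise k
  | .inr s => τ.u s

/-- The run obeys the equations of the system up to the horizon `T`. -/
def Follows (τ : Trajectory n m p Ω) (S : LinearSystem n m p) (T : ℕ) : Prop :=
  (∀ s < T, ∀ ω, τ.x (s + 1) ω
    = S.A.toEuclideanLin (τ.x s ω) + S.B.toEuclideanLin (τ.u s ω) + τ.w s ω) ∧
  ∀ s ≤ T, ∀ ω, τ.y s ω = S.C.toEuclideanLin (τ.x s ω) + τ.v s ω

/-- The vector `[u(0); …; u(t-1); y(0); …; y(t)]`. -/
def past (τ : Trajectory n m p Ω) (t : ℕ) (ω : Ω) : EuclideanSpace ℝ (PastIndex m p t) :=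
  WithLp.toLp 2 (Sum.elim (fun k => τ.u k.1 ω k.2) (fun k => τ.y k.1 ω k.2))

variable [MeasurableSpace Ω]

/-- The initial state and the noises up to the horizon `T` are centred Gaussian vectors with the
covariances of the system. -/
def GaussianNoise (τ : Trajectory n m p Ω) (S : LinearSystem n m p) (T : ℕ) (μ : Measure Ω) :
    Prop :=
  ∀ k : NoiseSource T, Measurable (τ.noise k) ∧
    μ.map (τ.noise k) = multivariateGaussian 0 (S.noiseCov k)

/-- A run with an arbitrary causal input: `x(0)`, `w(s)`, `v(s)` are independent Gaussian vectors,
and each input `u(s)` may depend measurably on the outputs `y(0), …, y(s)` and on exogenous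
information `𝓖` which is independent of the initial state and the noise. -/
structure IsCausalRun {Ω : Type*} (𝓖 : MeasurableSpace Ω) [mΩ : MeasurableSpace Ω]
    (τ : Trajectory n m p Ω) (S : LinearSystem n m p) (T : ℕ) (μ : Measure Ω) : Prop where
  follows : τ.Follows S T
  gaussian : τ.GaussianNoise S T μ
  indep : iIndepFun (fun k : NoiseSource T => τ.noise k) μ
  exogenous_le : 𝓖 ≤ mΩ
  exogenous_indep :
    Indep 𝓖 (⨆ k : NoiseSource T, MeasurableSpace.comap (τ.noise k) inferInstance) μ
  causal : ∀ s < T, Measurable[𝓖 ⊔ ⨆ r : Fin (s + 1),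
    MeasurableSpace.comap (τ.y r) inferInstance] (τ.u s)

end Trajectory

variable [MeasurableSpace Ω]

/-- Independent experiments `i = 0, 1, 2, …` of horizon `T`, with inputs `u^i(s) ∼ N(0, Su)`:
the initial states, the noises and the inputs of all experiments at all times are independent. -/
structure IsDataset (D : ℕ → Trajectory n m p Ω) (S : LinearSystem n m p)
    (Su : Matrix (Fin m) (Fin m) ℝ) (T : ℕ) (μ : Measure Ω) : Prop where
  follows : ∀ i, (D i).Follows S T
  gaussian : ∀ i, (D i).GaussianNoise S T μ
  input_gaussian : ∀ i, ∀ s < T, Measurable ((D i).u s) ∧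
    μ.map ((D i).u s) = multivariateGaussian 0 Su
  indep : iIndepFun (fun k : ℕ × (NoiseSource T ⊕ Fin T) => (D k.1).source k.2) μ

/-! ### The data-driven gain -/

/-- `X_t`: the states at time `t` of the first `N` experiments, as columns. -/
def stateData (D : ℕ → Trajectory n m p Ω) (N t : ℕ) (ω : Ω) : Matrix (Fin n) (Fin N) ℝ :=
  Matrix.of fun a i => (D i).x t ω a

/-- `U_{t-1}`: the inputs at the times `0, …, t-1` of the first `N` experiments, as columns. -/
def inputData (D : ℕ → Trajectory n m p Ω) (N t : ℕ) (ω : Ω) :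
    Matrix (Fin t × Fin m) (Fin N) ℝ :=
  Matrix.of fun k i => (D i).u k.1 ω k.2

/-- `Y_t`: the outputs at the times `0, …, t` of the first `N` experiments, as columns. -/
def outputData (D : ℕ → Trajectory n m p Ω) (N t : ℕ) (ω : Ω) :
    Matrix (Fin (t + 1) × Fin p) (Fin N) ℝ :=
  Matrix.of fun k i => (D i).y k.1 ω k.2

/-- The data-driven gain `X_t [U_{t-1}; Y_t]†`. -/
noncomputable def dataGain (D : ℕ → Trajectory n m p Ω) (N t : ℕ) (ω : Ω) :
    Matrix (Fin n) (PastIndex m p t) ℝ :=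
  stateData D N t ω * pinv (Matrix.fromRows (inputData D N t ω) (outputData D N t ω))

/-! ### The Kalman estimate and the constant -/

/-- `xhat` is the Kalman estimate of the state at time `t`: the function of
`u(0), …, u(t-1), y(0), …, y(t)` that minimizes the mean square error among all of them. -/
def IsKalmanEstimate (τ : Trajectory n m p Ω) (t : ℕ) (μ : Measure Ω)
    (xhat : Ω → EuclideanSpace ℝ (Fin n)) : Prop :=
  (∃ g : EuclideanSpace ℝ (PastIndex m p t) → EuclideanSpace ℝ (Fin n),
    Measurable g ∧ ∀ ω, xhat ω = g (τ.past t ω)) ∧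
  ∀ g : EuclideanSpace ℝ (PastIndex m p t) → EuclideanSpace ℝ (Fin n), Measurable g →
    ∫⁻ ω, ‖τ.x t ω - xhat ω‖ₑ ^ 2 ∂μ ≤ ∫⁻ ω, ‖τ.x t ω - g (τ.past t ω)‖ₑ ^ 2 ∂μ

/-- The covariance matrix of a random vector. -/
noncomputable def covMat {ι : Type*} (X : Ω → EuclideanSpace ℝ ι) (μ : Measure Ω) :
    Matrix ι ι ℝ :=
  Matrix.of fun a b => covariance (fun ω => X ω a) (fun ω => X ω b) μ

end

open scoped MatrixOrder Matrix.Norms.L2Operator in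
/-- `16 ‖SZ^{-1/2}‖₂ ‖Se‖₂^{1/2} √(((m+p)t+n+p) log(9/δ))`, with spectral norms. -/
noncomputable def kalmanConst (n m p t : ℕ) (δ : ℝ)
    (SZ : Matrix (PastIndex m p t) (PastIndex m p t) ℝ) (Se : Matrix (Fin n) (Fin n) ℝ) : ℝ :=
  16 * ‖(CFC.sqrt SZ)⁻¹‖ * √‖Se‖ *
    √((((m : ℝ) + p) * t + n + p) * Real.log (9 / δ))

end DataKF

/-!
The state of a run is the sum of the response to the inputs, which is a known linear function of
the past `z = [u(0); …; u(t-1); y(0); …; y(t)]`, and of the response to the noise. After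
subtraction of the first, the outputs are those of the system without inputs; regressing the free
state on the free outputs, which are jointly Gaussian, gives `x(t) = L z + e` with one matrix `L`
and one linear function `e` of the noise for *all* runs, whatever their causal inputs
(`Trajectory.Follows.state_eq_estimate_add_error`, `exists_regression_gain`). The error `e` is
independent of the past, because the past is a function of the free outputs and of exogenous
information (`Trajectory.IsCausalRun.indepFun_error_past`); hence `L z` is the Kalman estimate
almost surely (`IsKalmanEstimate.ae_eq`), and `e` has the covariance `Σ_e` in every run.

For the data this reads `X_t = L Z + E` with `Z = [U_{t-1}; Y_t]`, where the columns of `Z` are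
i.i.d. with law `N(0, Σ_Z)`, the columns of `E` are i.i.d. with law `N(0, Σ_e)`, and `E` and `Z` are
independent. If `Z` has full row rank, then `X_t Z† = L + E Z†` (`dataGain_apply_eq`), so the
estimates differ by `E Z† z`, and everything comes down to a bound on `‖E Z†‖`
(`measure_noise_mul_pinv_le`): the smallest singular value of the whitened matrix
`Σ_Z^{-1/2} Z` is bounded below with probability at least `1 - δ`, and, given `Z`, the entries
`⟨a, E Z† b⟩` are sub-Gaussian, so that their supremum over unit vectors is bounded with probability
at least `1 - δ`. Both bounds are proved on finite nets of the unit spheres, by a union bound over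
Chernoff bounds, and extended from there.
-/

namespace DataKF

/-! ### Nets of the unit sphere -/

section Nets

variable {E : Type*} [NormedAddCommGroup E] [NormedSpace ℝ E] [FiniteDimensional ℝ E]

open scoped Function in
/-- An `ε`-separated subset of the unit ball has at most `(1 + 2/ε) ^ dim` points: the balls of
radius `ε/2` around them are disjoint and lie in the ball of radius `1 + ε/2`. -/
theorem card_le_of_separated_of_norm_le_one {ε : ℝ} (hε : 0 < ε) (s : Finset E)
    (hs : ∀ c ∈ s, ‖c‖ ≤ 1) (h : ∀ c ∈ s, ∀ d ∈ s, c ≠ d → ε ≤ ‖c - d‖) :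
    (s.card : ℝ) ≤ (1 + 2 / ε) ^ Module.finrank ℝ E := by
  borelize E
  let μ : Measure E := Measure.addHaar
  have hr : 0 < ε / 2 := by positivity
  have hρ : 0 < 1 + ε / 2 := by positivity
  have hD : Set.Pairwise (s : Set E) (Disjoint on fun c => Metric.ball (c : E) (ε / 2)) := by
    rintro c hc d hd hcd
    apply Metric.ball_disjoint_ball
    rw [dist_eq_norm]
    linarith [h c hc d hd hcd]
  have hsub : (⋃ c ∈ s, Metric.ball (c : E) (ε / 2)) ⊆ Metric.ball (0 : E) (1 + ε / 2) := by
    refine Set.iUnion₂_subset fun x hx => Metric.ball_subset_ball' ?_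
    rw [dist_zero_right]
    linarith [hs x hx]
  have hvol : (s.card : ENNReal) * ENNReal.ofReal ((ε / 2) ^ Module.finrank ℝ E)
      * μ (Metric.ball 0 1)
      ≤ ENNReal.ofReal ((1 + ε / 2) ^ Module.finrank ℝ E) * μ (Metric.ball 0 1) := by
    have h1 := measure_mono (μ := μ) hsub
    rw [measure_biUnion_finset hD fun c _ => measurableSet_ball] at h1
    simpa only [μ.addHaar_ball_of_pos _ hr, μ.addHaar_ball_of_pos _ hρ, Finset.sum_const,
      nsmul_eq_mul, mul_assoc] using h1
  have hcard : (s.card : ENNReal) * ENNReal.ofReal ((ε / 2) ^ Module.finrank ℝ E)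
      ≤ ENNReal.ofReal ((1 + ε / 2) ^ Module.finrank ℝ E) :=
    (ENNReal.mul_le_mul_iff_left (Metric.measure_ball_pos _ _ zero_lt_one).ne'
      measure_ball_lt_top.ne).1 hvol
  have hreal := ENNReal.toReal_le_of_le_ofReal (by positivity) hcard
  rw [ENNReal.toReal_mul, ENNReal.toReal_natCast, ENNReal.toReal_ofReal (by positivity),
    ← le_div_iff₀ (by positivity), ← div_pow] at hreal
  rwa [show (1 + ε / 2) / (ε / 2) = 1 + 2 / ε by field_simp; ring] at hreal

/-- The unit sphere has an `ε`-net with at most `(1 + 2/ε) ^ dim` points. -/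
theorem exists_sphere_net {ε : ℝ} (hε : 0 < ε) :
    ∃ s : Finset E, (∀ u ∈ s, ‖u‖ = 1) ∧ (s.card : ℝ) ≤ (1 + 2 / ε) ^ Module.finrank ℝ E ∧
      ∀ v : E, ‖v‖ = 1 → ∃ u ∈ s, ‖v - u‖ < ε := by
  classical
  let P : ℕ → Prop := fun k => ∃ s : Finset E, s.card = k ∧ (∀ u ∈ s, ‖u‖ = 1) ∧
    ∀ c ∈ s, ∀ d ∈ s, c ≠ d → ε ≤ ‖c - d‖
  have hbd : ∀ k, P k → k ≤ ⌊(1 + 2 / ε) ^ Module.finrank ℝ E⌋₊ := by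
    rintro k ⟨s, rfl, hs, hsep⟩
    exact Nat.le_floor (card_le_of_separated_of_norm_le_one hε s (fun c hc => (hs c hc).le) hsep)
  have h0 : P 0 := ⟨∅, by simp⟩
  -- a separated set with as many points as possible is a net
  obtain ⟨m, hm, hmax⟩ : ∃ m, P m ∧ ∀ k, P k → k ≤ m :=
    ⟨_, Nat.findGreatest_spec (P := P) (Nat.zero_le _) h0,
      fun k hk => Nat.le_findGreatest (hbd k hk) hk⟩
  obtain ⟨s, rfl, hs, hsep⟩ := hm
  refine ⟨s, hs, card_le_of_separated_of_norm_le_one hε s (fun c hc => (hs c hc).le) hsep, ?_⟩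
  intro v hv
  by_contra! hfar
  have hvs : v ∉ s := fun hmem => by simpa [hε.not_ge] using hfar v hmem
  have hP : P (s.card + 1) := by
    refine ⟨insert v s, Finset.card_insert_of_notMem hvs, ?_, ?_⟩
    · intro u hu
      rcases Finset.mem_insert.1 hu with rfl | hu
      exacts [hv, hs u hu]
    · intro c hc d hd hcd
      rcases Finset.mem_insert.1 hc with hc | hc <;> rcases Finset.mem_insert.1 hd with hd | hd
      · exact absurd (hc.trans hd.symm) hcd
      · rw [hc]; exact hfar d hd
      · rw [hd, norm_sub_rev]; exact hfar c hc
      · exact hsep c hc d hd hcd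
  exact absurd (hmax _ hP) (by omega)

theorem norm_le_of_unit_bound {F : Type*} [NormedAddCommGroup F] [NormedSpace ℝ F]
    (T : E →ₗ[ℝ] F) {c : ℝ} (h : ∀ v, ‖v‖ = 1 → ‖T v‖ ≤ c) (v : E) : ‖T v‖ ≤ c * ‖v‖ := by
  rcases eq_or_ne v 0 with rfl | hv
  · simp
  have h1 := h (‖v‖⁻¹ • v) (norm_smul_inv_norm (𝕜 := ℝ) hv)
  rwa [map_smul, norm_smul, norm_inv, norm_norm, inv_mul_le_iff₀ (norm_pos_iff.2 hv),
    mul_comm] at h1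

/-- A linear map which is bounded by `c` on an `ε`-net of the unit sphere has norm at most
`c / (1 - ε)`. -/
theorem norm_le_of_net {F : Type*} [NormedAddCommGroup F] [NormedSpace ℝ F]
    (T : E →ₗ[ℝ] F) {c ε : ℝ} (hε : ε < 1) {s : Finset E}
    (hnet : ∀ v : E, ‖v‖ = 1 → ∃ u ∈ s, ‖v - u‖ < ε) (h : ∀ u ∈ s, ‖T u‖ ≤ c) (v : E) :
    ‖T v‖ ≤ c / (1 - ε) * ‖v‖ := by
  let T' : E →L[ℝ] F := LinearMap.toContinuousLinearMap T
  suffices hT : ∀ w, ‖w‖ = 1 → ‖T w‖ ≤ c + ‖T'‖ * ε by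
    by_cases hE : ∃ w : E, ‖w‖ = 1
    · obtain ⟨w, hw⟩ := hE
      have hc : 0 ≤ c := by
        obtain ⟨u, hu, -⟩ := hnet w hw
        exact (norm_nonneg _).trans (h u hu)
      obtain ⟨u, hu, hu'⟩ := hnet w hw
      have hε0 : 0 < ε := (norm_nonneg _).trans_lt hu'
      have h1 : ‖T'‖ ≤ c + ‖T'‖ * ε :=
        T'.opNorm_le_bound (by positivity) (norm_le_of_unit_bound T hT)
      have h2 : ‖T'‖ ≤ c / (1 - ε) := by
        rw [le_div_iff₀ (by linarith)]; linarith
      exact (T'.le_opNorm v).trans (by gcongr)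
    · have hv : v = 0 := by
        by_contra hv
        exact hE ⟨_, norm_smul_inv_norm (𝕜 := ℝ) hv⟩
      simp [hv]
  intro w hw
  obtain ⟨u, hu, hu'⟩ := hnet w hw
  calc ‖T w‖ = ‖T u + T' (w - u)‖ := by simp [T']
    _ ≤ ‖T u‖ + ‖T' (w - u)‖ := norm_add_le _ _
    _ ≤ c + ‖T'‖ * ε := by
      gcongr
      · exact h u hu
      · exact (T'.le_opNorm _).trans (by gcongr)

theorem norm_le_of_inner_net {F : Type*} [NormedAddCommGroup F] [InnerProductSpace ℝ F]
    {c ε : ℝ} (hε : ε < 1) {s : Finset F}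
    (hnet : ∀ v : F, ‖v‖ = 1 → ∃ u ∈ s, ‖v - u‖ < ε) (w : F) (hc : 0 ≤ c)
    (h : ∀ u ∈ s, inner ℝ u w ≤ c) : ‖w‖ ≤ c / (1 - ε) := by
  rcases eq_or_ne w 0 with rfl | hw
  · simpa using div_nonneg hc (by linarith)
  have hw' : 0 < ‖w‖ := norm_pos_iff.2 hw
  obtain ⟨u, hu, hu'⟩ := hnet (‖w‖⁻¹ • w) (norm_smul_inv_norm (𝕜 := ℝ) hw)
  have h1 : ‖w‖ = inner ℝ u w + inner ℝ (‖w‖⁻¹ • w - u) w := by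
    rw [inner_sub_left, real_inner_smul_left, real_inner_self_eq_norm_sq]
    field_simp
    ring
  have h2 : inner ℝ (‖w‖⁻¹ • w - u) w ≤ ε * ‖w‖ :=
    (real_inner_le_norm _ _).trans (by gcongr)
  rw [le_div_iff₀ (by linarith)]
  nlinarith [h u hu]

end Nets

/-! ### Tails of sums of squares of Gaussian variables -/

section ChiSquare

open Real

theorem gaussianReal_exp_mul_sq {t : ℝ} (ht : t < 1 / 2) :
    Integrable (fun x => exp (t * x ^ 2)) (gaussianReal 0 1) ∧
      ∫ x, exp (t * x ^ 2) ∂(gaussianReal 0 1) = (√(1 - 2 * t))⁻¹ := by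
  have hb : 0 < 1 / 2 - t := by linarith
  have hfun : ∀ x : ℝ, gaussianPDFReal 0 1 x * exp (t * x ^ 2)
      = (√(2 * π))⁻¹ * exp (-(1 / 2 - t) * x ^ 2) := by
    intro x
    rw [gaussianPDFReal, mul_assoc, ← exp_add]
    simp only [NNReal.coe_one, mul_one, sub_zero]
    congr 2
    ring
  constructor
  · rw [gaussianReal_of_var_ne_zero _ one_ne_zero, gaussianPDF_def,
      integrable_withDensity_iff_integrable_smul₀' (by fun_prop) (by simp)]
    refine ((integrable_exp_neg_mul_sq hb).const_mul (√(2 * π))⁻¹).congr (.of_forall fun x => ?_)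
    simp only [smul_eq_mul]
    rw [ENNReal.toReal_ofReal (gaussianPDFReal_nonneg _ _ _), hfun]
  · rw [integral_gaussianReal_eq_integral_smul one_ne_zero]
    simp only [smul_eq_mul, hfun]
    rw [integral_const_mul, integral_gaussian, ← sqrt_inv, ← sqrt_inv, ← sqrt_mul (by positivity)]
    congr 1
    have h1 : 1 - 2 * t ≠ 0 := by linarith
    field_simp

variable {Ω : Type*} [MeasurableSpace Ω] {μ : Measure Ω} {ι : Type*} [Fintype ι]

theorem sum_sq_exp_moment {g : ι → Ω → ℝ} (hg : iIndepFun g μ) (hm : ∀ i, Measurable (g i))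
    (hlaw : ∀ i, μ.map (g i) = gaussianReal 0 1) {t : ℝ} (ht : t < 1 / 2) :
    Integrable (fun ω => exp (t * ∑ i, g i ω ^ 2)) μ ∧
      mgf (fun ω => ∑ i, g i ω ^ 2) μ t = (√(1 - 2 * t))⁻¹ ^ Fintype.card ι := by
  have := hg.isProbabilityMeasure
  have hsq : iIndepFun (fun i ω => g i ω ^ 2) μ :=
    hg.comp (fun _ x => x ^ 2) (fun _ => by fun_prop)
  have hint : ∀ i, Integrable (fun ω => exp (t * g i ω ^ 2)) μ := fun i => by
    have := (gaussianReal_exp_mul_sq ht).1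
    rw [← hlaw i, integrable_map_measure (by fun_prop) (by fun_prop)] at this
    exact this
  have hmgf : ∀ i, mgf (fun ω => g i ω ^ 2) μ t = (√(1 - 2 * t))⁻¹ := fun i => by
    have := (gaussianReal_exp_mul_sq ht).2
    rw [← hlaw i, integral_map (by fun_prop) (by fun_prop)] at this
    exact this
  have hs : (∑ i, fun ω => g i ω ^ 2) = fun ω => ∑ i, g i ω ^ 2 := by ext; simp
  constructor
  · have := hsq.integrable_exp_mul_sum (t := t) (fun i => by fun_prop) (s := Finset.univ)
      (fun i _ => hint i)
    simpa [hs] using this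
  · have := hsq.mgf_sum (t := t) (fun i => by fun_prop) Finset.univ
    rw [hs] at this
    rw [this]
    simp [hmgf]

theorem sum_sq_lower_tail {g : ι → Ω → ℝ} (hg : iIndepFun g μ) (hm : ∀ i, Measurable (g i))
    (hlaw : ∀ i, μ.map (g i) = gaussianReal 0 1) :
    μ.real {ω | ∑ i, g i ω ^ 2 ≤ Fintype.card ι / 9} ≤ (exp (4 / 9) / 3) ^ Fintype.card ι := by
  have := hg.isProbabilityMeasure
  -- the Chernoff bound is optimal for `1 - 2 t = 9`
  have h := sum_sq_exp_moment hg hm hlaw (t := -4) (by norm_num)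
  have hc := measure_le_le_exp_mul_mgf (X := fun ω => ∑ i, g i ω ^ 2) (Fintype.card ι / 9 : ℝ)
    (by norm_num) h.1
  rw [h.2, show (1 - 2 * (-4) : ℝ) = 3 ^ 2 by norm_num, sqrt_sq (by norm_num)] at hc
  refine hc.trans_eq ?_
  rw [div_eq_mul_inv (exp _), mul_pow, ← exp_nat_mul]
  congr 2
  ring

theorem sum_sq_upper_tail {g : ι → Ω → ℝ} (hg : iIndepFun g μ) (hm : ∀ i, Measurable (g i))
    (hlaw : ∀ i, μ.map (g i) = gaussianReal 0 1) :
    μ.real {ω | 4 * Fintype.card ι ≤ ∑ i, g i ω ^ 2} ≤ (2 * exp (-3 / 2)) ^ Fintype.card ι := by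
  have := hg.isProbabilityMeasure
  -- the Chernoff bound is optimal for `1 - 2 t = 1/4`
  have h := sum_sq_exp_moment hg hm hlaw (t := 3 / 8) (by norm_num)
  have hc := measure_ge_le_exp_mul_mgf (X := fun ω => ∑ i, g i ω ^ 2) (4 * Fintype.card ι : ℝ)
    (by norm_num) h.1
  rw [h.2, show (1 - 2 * (3 / 8) : ℝ) = (1 / 2) ^ 2 by norm_num, sqrt_sq (by norm_num)] at hc
  refine hc.trans_eq ?_
  rw [mul_comm, mul_pow, ← exp_nat_mul]
  congr 1
  · norm_num
  · congr 1; ring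

end ChiSquare

/-! ### Gaussian linear forms with independent coefficients -/

section LinearForm

variable {Ω : Type*} [MeasurableSpace Ω] {μ : Measure Ω} {ι : Type*} [Fintype ι]

theorem HasSubgaussianMGF.mono {X : Ω → ℝ} {c c' : NNReal} (h : HasSubgaussianMGF X c μ)
    (hc : c ≤ c') : HasSubgaussianMGF X c' μ :=
  ⟨h.1, fun t => (h.2 t).trans (by gcongr)⟩

theorem HasSubgaussianMGF.measure_gt_le [IsProbabilityMeasure μ] {X : Ω → ℝ} {σ : NNReal}
    (h : HasSubgaussianMGF X (σ ^ 2) μ) {s : ℝ} (hs : 0 ≤ s) :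
    μ {ω | s * σ < X ω} ≤ ENNReal.ofReal (Real.exp (-s ^ 2 / 2)) := by
  rcases eq_or_ne σ 0 with rfl | hσ
  · have h0 : μ {ω | s * ((0 : NNReal) : ℝ) < X ω} = 0 := by
      have := HasSubgaussianMGF.ae_eq_zero_of_hasSubgaussianMGF_zero (X := X) (μ := μ)
        (by simpa using h)
      have h1 : ∀ᵐ ω ∂μ, ¬ (s * ((0 : NNReal) : ℝ) < X ω) := by
        filter_upwards [this] with ω hω
        simp [hω]
      simpa using ae_iff.1 h1
    rw [h0]
    exact zero_le
  · have h1 := ProbabilityTheory.HasSubgaussianMGF.measure_ge_le h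
      (ε := s * σ) (by positivity)
    have hσ' : (σ : ℝ) ≠ 0 := by exact_mod_cast hσ
    have h2 : -(s * σ) ^ 2 / (2 * ((σ ^ 2 : NNReal) : ℝ)) = -s ^ 2 / 2 := by
      push_cast
      field_simp
    rw [h2] at h1
    calc μ {ω | s * σ < X ω} ≤ μ {ω | s * σ ≤ X ω} :=
          measure_mono fun ω hω => le_of_lt (Set.mem_ofPred.1 hω)
      _ ≤ _ := by
        rw [← ofReal_measureReal]
        exact ENNReal.ofReal_le_ofReal h1

/-- If independent sub-Gaussian variables `e i` are independent of `Z`, then a combination of them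
with coefficients of Euclidean norm at most one which depend on `Z` is sub-Gaussian with the same
parameter: this holds conditionally on `Z`. -/
theorem measure_linearForm_gt_le [IsProbabilityMeasure μ] {𝓩 : Type*} [MeasurableSpace 𝓩]
    {Z : Ω → 𝓩} (hZ : Measurable Z) {e : ι → Ω → ℝ} (he : ∀ i, Measurable (e i))
    (hind : iIndepFun e μ) (hZe : IndepFun Z (fun ω i => e i ω) μ) {σ : NNReal}
    (hsub : ∀ i, HasSubgaussianMGF (e i) (σ ^ 2) μ)
    {f : ι → 𝓩 → ℝ} (hf : ∀ i, Measurable (f i)) (hf1 : ∀ z, ∑ i, f i z ^ 2 ≤ 1)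
    {s : ℝ} (hs : 0 ≤ s) :
    μ {ω | s * σ < ∑ i, f i (Z ω) * e i ω} ≤ ENNReal.ofReal (Real.exp (-s ^ 2 / 2)) := by
  let A : Set (𝓩 × (ι → ℝ)) := {q | s * σ < ∑ i, f i q.1 * q.2 i}
  have hA : MeasurableSet A := measurableSet_lt (by fun_prop) (by fun_prop)
  have hpair := (indepFun_iff_map_prod_eq_prod_map_map hZ.aemeasurable
    (measurable_pi_lambda _ he).aemeasurable).1 hZe
  have hpre : {ω | s * σ < ∑ i, f i (Z ω) * e i ω}
      = (fun ω => (Z ω, fun i => e i ω)) ⁻¹' A := rfl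
  have : IsProbabilityMeasure (μ.map Z) := Measure.isProbabilityMeasure_map hZ.aemeasurable
  have : IsProbabilityMeasure (μ.map fun ω i => e i ω) :=
    Measure.isProbabilityMeasure_map (measurable_pi_lambda _ he).aemeasurable
  rw [hpre, ← Measure.map_apply (hZ.prodMk (measurable_pi_lambda _ he)) hA, hpair,
    Measure.prod_apply hA]
  refine (lintegral_mono (g := fun _ => ENNReal.ofReal (Real.exp (-s ^ 2 / 2))) fun z => ?_).trans
    (by simp)
  rw [Measure.map_apply (measurable_pi_lambda _ he) (hA.preimage (by fun_prop))]
  refine HasSubgaussianMGF.measure_gt_le (X := fun ω => ∑ i, f i z * e i ω) ?_ hs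
  have h1 : iIndepFun (fun i ω => f i z * e i ω) μ :=
    hind.comp (fun i x => f i z * x) (fun i => by fun_prop)
  have h3 : ∀ i, HasSubgaussianMGF (fun ω => f i z * e i ω) (‖f i z‖₊ ^ 2 * σ ^ 2) μ := by
    intro i
    refine HasSubgaussianMGF.mono ((hsub i).const_mul (f i z)) (mul_le_mul_left ?_ _)
    refine NNReal.coe_le_coe.1 ?_
    change f i z ^ 2 ≤ ‖f i z‖ ^ 2
    rw [Real.norm_eq_abs, sq_abs]
  refine HasSubgaussianMGF.mono (HasSubgaussianMGF.sum_of_iIndepFun h1 (s := Finset.univ)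
    (fun i _ => h3 i)) ?_
  rw [← Finset.sum_mul, ← NNReal.coe_le_coe]
  push_cast
  simp only [Real.norm_eq_abs, sq_abs]
  exact mul_le_of_le_one_left (by positivity) (hf1 z)

end LinearForm

/-! ### The smallest singular value of a Gaussian matrix -/

section SingularValue

open Real

/-- Both Chernoff factors are at most `exp (-5/8)`, which beats the cardinality of a net with at
most `exp (5 d)` points. -/
theorem pow_mul_pow_le_sq {a b δ : ℝ} {d N : ℕ} (ha0 : 0 ≤ a) (ha : a ≤ exp 5) (hb0 : 0 ≤ b)
    (hb : b ≤ exp (-(5 / 8))) (hδ : 0 < δ) (hδ1 : δ ≤ 1)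
    (hN : 8 * (d : ℝ) + 16 * log (1 / δ) ≤ N) : a ^ d * b ^ N ≤ δ ^ 2 := by
  have hL : 0 ≤ log (1 / δ) := log_nonneg (by rw [le_div_iff₀ hδ]; linarith)
  calc a ^ d * b ^ N ≤ exp 5 ^ d * exp (-(5 / 8)) ^ N := by gcongr
    _ = exp (d * 5 + N * -(5 / 8)) := by rw [exp_add, exp_nat_mul, exp_nat_mul]
    _ ≤ exp (-(2 * log (1 / δ))) := exp_le_exp.2 (by linarith)
    _ = δ ^ 2 := by
      rw [one_div, log_inv, show -(2 * -log δ) = ((2 : ℕ) : ℝ) * log δ by push_cast; ring,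
        exp_nat_mul, exp_log hδ]

theorem exp_four_ninths_div_three_le : exp (4 / 9) / 3 ≤ exp (-(5 / 8)) := by
  have h1 : exp (5 / 72) ≤ 72 / 67 := by
    have h := add_one_le_exp (-(5 / 72) : ℝ)
    rw [exp_neg] at h
    have h' : exp (5 / 72) * (67 / 72) ≤ 1 := by
      calc exp (5 / 72) * (67 / 72) ≤ exp (5 / 72) * (exp (5 / 72))⁻¹ := by gcongr; linarith
        _ = 1 := mul_inv_cancel₀ (exp_pos _).ne'
    linarith
  have h2 : exp (4 / 9) * exp (5 / 8) ≤ 3 := by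
    rw [← exp_add, show (4 / 9 + 5 / 8 : ℝ) = 1 + 5 / 72 by norm_num, exp_add]
    nlinarith [exp_one_lt_d9, exp_pos 1, exp_pos (5 / 72)]
  rw [exp_neg, div_le_iff₀ (by norm_num), inv_mul_eq_div, le_div_iff₀ (exp_pos _)]
  exact h2

theorem two_mul_exp_neg_le : 2 * exp (-3 / 2) ≤ exp (-(5 / 8)) := by
  have h := quadratic_le_exp_of_nonneg (x := 7 / 8) (by norm_num)
  have h2 : exp (-(5 / 8)) = exp (7 / 8) * exp (-3 / 2) := by rw [← exp_add]; norm_num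
  rw [h2]
  gcongr
  norm_num at h
  linarith

theorem sixtyone_le_exp_five : (61 : ℝ) ≤ exp 5 := by
  have h : exp 5 = exp 1 ^ 5 := by rw [← exp_nat_mul]; norm_num
  rw [h]
  calc (61 : ℝ) ≤ 2.7 ^ 5 := by norm_num
    _ ≤ exp 1 ^ 5 := by gcongr; linarith [exp_one_gt_d9]

variable {Ω : Type*} [MeasurableSpace Ω] {μ : Measure Ω} {N : ℕ}

theorem measure_biUnion_le_ofReal {α : Type*} (s : Finset α) (A : α → Set Ω) {c b q : ℝ}
    (hb : 0 ≤ b) (hc : (s.card : ℝ) ≤ c) (hA : ∀ u ∈ s, μ (A u) ≤ ENNReal.ofReal b)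
    (hq : c * b ≤ q) : μ (⋃ u ∈ s, A u) ≤ ENNReal.ofReal q := by
  calc μ (⋃ u ∈ s, A u) ≤ ∑ u ∈ s, μ (A u) := measure_biUnion_finset_le s A
    _ ≤ ∑ _u ∈ s, ENNReal.ofReal b := Finset.sum_le_sum hA
    _ = ENNReal.ofReal (s.card * b) := by
      rw [Finset.sum_const, nsmul_eq_mul, ENNReal.ofReal_mul (by positivity),
        ENNReal.ofReal_natCast]
    _ ≤ ENNReal.ofReal q := ENNReal.ofReal_le_ofReal (le_trans (by gcongr) hq)

/-- A random linear map `T` into `ℝ^N` such that `T v` is a standard Gaussian vector for each unit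
vector `v` (a Gaussian matrix) is bounded below by `√N / 5` with high probability. -/
theorem measure_not_bounded_below_le [IsProbabilityMeasure μ]
    {E : Type*} [NormedAddCommGroup E] [NormedSpace ℝ E] [FiniteDimensional ℝ E]
    (T : Ω → E →ₗ[ℝ] EuclideanSpace ℝ (Fin N))
    (hm : ∀ v i, Measurable fun ω => T ω v i)
    (hind : ∀ v, iIndepFun (fun i ω => T ω v i) μ)
    (hlaw : ∀ v, ‖v‖ = 1 → ∀ i, μ.map (fun ω => T ω v i) = gaussianReal 0 1)
    {δ : ℝ} (hδ : 0 < δ) (hδ' : δ ≤ 1 / 2)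
    (hN : 8 * (Module.finrank ℝ E : ℝ) + 16 * log (1 / δ) ≤ N) :
    μ {ω | ¬ ∀ v, √N / 5 * ‖v‖ ≤ ‖T ω v‖} ≤ ENNReal.ofReal δ := by
  -- the coarse net gives `‖T‖ ≤ 4 √N`; then passing from the fine net to the sphere loses
  -- `4 √N / 30` of the lower bound `√N / 3`, which leaves `√N / 5`
  obtain ⟨s₁, hs₁, hc₁, hn₁⟩ := exists_sphere_net (E := E) (ε := 1 / 2) (by norm_num)
  obtain ⟨s₂, hs₂, hc₂, hn₂⟩ := exists_sphere_net (E := E) (ε := 1 / 30) (by norm_num)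
  norm_num at hc₁ hc₂
  let A₁ : E → Set Ω := fun u => {ω | 4 * (N : ℝ) ≤ ∑ i, T ω u i ^ 2}
  let A₂ : E → Set Ω := fun u => {ω | ∑ i, T ω u i ^ 2 ≤ (N : ℝ) / 9}
  have hA₁ : ∀ u ∈ s₁, μ (A₁ u) ≤ ENNReal.ofReal ((2 * exp (-3 / 2)) ^ N) := fun u hu => by
    rw [← ofReal_measureReal]
    exact ENNReal.ofReal_le_ofReal (by
      simpa using sum_sq_upper_tail (hind u) (hm u) (hlaw u (hs₁ u hu)))
  have hA₂ : ∀ u ∈ s₂, μ (A₂ u) ≤ ENNReal.ofReal ((exp (4 / 9) / 3) ^ N) := fun u hu => by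
    rw [← ofReal_measureReal]
    exact ENNReal.ofReal_le_ofReal (by
      simpa using sum_sq_lower_tail (hind u) (hm u) (hlaw u (hs₂ u hu)))
  have hU₁ : μ (⋃ u ∈ s₁, A₁ u) ≤ ENNReal.ofReal (δ ^ 2) :=
    measure_biUnion_le_ofReal s₁ A₁ (by positivity) hc₁ hA₁
      (pow_mul_pow_le_sq (by norm_num) (by linarith [sixtyone_le_exp_five]) (by positivity)
        two_mul_exp_neg_le hδ (by linarith) hN)
  have hU₂ : μ (⋃ u ∈ s₂, A₂ u) ≤ ENNReal.ofReal (δ ^ 2) :=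
    measure_biUnion_le_ofReal s₂ A₂ (by positivity) hc₂ hA₂
      (pow_mul_pow_le_sq (by norm_num) sixtyone_le_exp_five (by positivity)
        exp_four_ninths_div_three_le hδ (by linarith) hN)
  have hsub : {ω | ¬ ∀ v, √N / 5 * ‖v‖ ≤ ‖T ω v‖} ⊆ (⋃ u ∈ s₁, A₁ u) ∪ ⋃ u ∈ s₂, A₂ u := by
    intro ω hω
    by_contra hgood
    simp only [Set.mem_union, Set.mem_iUnion, A₁, A₂, Set.mem_ofPred_eq, not_or, not_exists,
      not_le] at hgood
    obtain ⟨hg₁, hg₂⟩ := hgood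
    have hup : ∀ v, ‖T ω v‖ ≤ 4 * √N * ‖v‖ := by
      intro v
      have h := norm_le_of_net (T ω) (c := 2 * √N) (by norm_num) hn₁ (fun u hu => ?_) v
      · refine h.trans_eq ?_
        ring
      · rw [EuclideanSpace.norm_eq, Real.sqrt_le_left (by positivity), mul_pow,
          sq_sqrt (by positivity)]
        simp only [Real.norm_eq_abs, sq_abs]
        linarith [hg₁ u hu]
    have hlow : ∀ v, ‖v‖ = 1 → √N / 5 ≤ ‖T ω v‖ := by
      intro v hv
      obtain ⟨u, hu, huv⟩ := hn₂ v hv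
      have h1 : √N / 3 ≤ ‖T ω u‖ := by
        rw [EuclideanSpace.norm_eq]
        apply Real.le_sqrt_of_sq_le
        simp only [Real.norm_eq_abs, sq_abs]
        rw [div_pow, sq_sqrt (by positivity)]
        linarith [hg₂ u hu]
      have h2 : ‖T ω u‖ ≤ ‖T ω v‖ + ‖T ω (v - u)‖ := by
        have : T ω u = T ω v - T ω (v - u) := by simp
        rw [this]
        exact norm_sub_le _ _
      have h3 : ‖T ω (v - u)‖ ≤ 4 * √N * (1 / 30) :=
        (hup _).trans (by gcongr)
      have : 0 ≤ √(N : ℝ) := sqrt_nonneg _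
      linarith
    refine hω fun v => ?_
    rcases eq_or_ne v 0 with rfl | hv
    · simp
    have h1 := hlow (‖v‖⁻¹ • v) (norm_smul_inv_norm (𝕜 := ℝ) hv)
    rw [map_smul, norm_smul, norm_inv, norm_norm, inv_mul_eq_div,
      le_div_iff₀ (norm_pos_iff.2 hv)] at h1
    exact h1
  calc _ ≤ μ (⋃ u ∈ s₁, A₁ u) + μ (⋃ u ∈ s₂, A₂ u) :=
        (measure_mono hsub).trans (measure_union_le _ _)
    _ ≤ ENNReal.ofReal (δ ^ 2) + ENNReal.ofReal (δ ^ 2) := add_le_add hU₁ hU₂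
    _ = ENNReal.ofReal (δ ^ 2 + δ ^ 2) := (ENNReal.ofReal_add (by positivity) (by positivity)).symm
    _ ≤ ENNReal.ofReal δ := ENNReal.ofReal_le_ofReal (by nlinarith)

/-- The product of a sub-Gaussian matrix (with columns `E i`) and a matrix `W` which is a function
of independent data: on an event of probability at least `1 - δ` the operator norm of the product is
bounded by the operator norm of `W`, without loss in the dimension `N`. -/
theorem measure_product_norm_gt_le [IsProbabilityMeasure μ]
    {ι κ : Type*} [Fintype ι] [Fintype κ] {𝓩 : Type*} [MeasurableSpace 𝓩]
    {Z : Ω → 𝓩} (hZ : Measurable Z) {e : Fin N → Ω → EuclideanSpace ℝ κ}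
    (he : ∀ i, Measurable (e i)) (hind : iIndepFun e μ)
    (hZe : IndepFun Z (fun ω i => e i ω) μ) {σ : NNReal}
    (hsub : ∀ i a, ‖a‖ = 1 → HasSubgaussianMGF (fun ω => inner ℝ a (e i ω)) (σ ^ 2) μ)
    (W : 𝓩 → EuclideanSpace ℝ ι →ₗ[ℝ] EuclideanSpace ℝ (Fin N))
    (hW : ∀ v i, Measurable fun z => W z v i)
    {δ : ℝ} (hδ : 0 < δ) (hδ' : δ ≤ 1 / 2) (hdim : 1 ≤ Fintype.card ι + Fintype.card κ) :
    μ {ω | ¬ ∀ c, 0 ≤ c → (∀ v, ‖W (Z ω) v‖ ≤ c * ‖v‖) → ∀ v, ‖∑ i, W (Z ω) v i • e i ω‖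
        ≤ 2 * c * √(2 * ((Fintype.card ι + Fintype.card κ) * log (9 / δ))) * σ * ‖v‖}
      ≤ ENNReal.ofReal δ := by
  obtain ⟨s₁, hs₁, hc₁, hn₁⟩ :=
    exists_sphere_net (E := EuclideanSpace ℝ ι) (ε := 1 / 4) (by norm_num)
  obtain ⟨s₂, hs₂, hc₂, hn₂⟩ :=
    exists_sphere_net (E := EuclideanSpace ℝ κ) (ε := 1 / 4) (by norm_num)
  norm_num at hc₁ hc₂
  set D : ℕ := Fintype.card ι + Fintype.card κ with hD
  set s : ℝ := √(2 * ((Fintype.card ι + Fintype.card κ) * log (9 / δ))) with hs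
  have hlog : 0 ≤ log (9 / δ) := log_nonneg (by rw [le_div_iff₀ hδ]; linarith)
  have hs2 : -s ^ 2 / 2 = -(D * log (9 / δ)) := by
    rw [hs, sq_sqrt (by positivity), hD]; push_cast; ring
  -- if `W z v = 0`, all coefficients `f v i z` are zero
  let f : EuclideanSpace ℝ ι → Fin N → 𝓩 → ℝ := fun v i z => W z v i / ‖W z v‖
  have hnorm : ∀ v, Measurable fun z => ‖W z v‖ := fun v => by
    simp only [EuclideanSpace.norm_eq]
    exact (Finset.measurable_sum _ fun i _ => (hW v i).norm.pow_const 2).sqrt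
  have hf : ∀ v i, Measurable (f v i) := fun v i => (hW v i).div (hnorm v)
  have hf1 : ∀ v z, ∑ i, f v i z ^ 2 ≤ 1 := fun v z => by
    simp only [f, div_pow]
    rw [← Finset.sum_div]
    have h := EuclideanSpace.norm_sq_eq (W z v)
    simp only [Real.norm_eq_abs, sq_abs] at h
    rw [← h]
    exact div_self_le_one _
  let A : EuclideanSpace ℝ ι × EuclideanSpace ℝ κ → Set Ω := fun q =>
    {ω | s * σ < ∑ i, f q.1 i (Z ω) * inner ℝ q.2 (e i ω)}
  have hA : ∀ q ∈ s₁ ×ˢ s₂, μ (A q) ≤ ENNReal.ofReal (exp (-s ^ 2 / 2)) := by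
    rintro ⟨v, a⟩ hq
    obtain ⟨hv, ha⟩ := Finset.mem_product.1 hq
    have hψ : Measurable fun (x : Fin N → EuclideanSpace ℝ κ) i => (inner ℝ a (x i) : ℝ) :=
      measurable_pi_lambda _ fun i => measurable_const.inner (measurable_pi_apply i)
    have hZe' : IndepFun Z (fun ω i => (inner ℝ a (e i ω) : ℝ)) μ :=
      hZe.comp measurable_id hψ
    have hind' : iIndepFun (fun i ω => (inner ℝ a (e i ω) : ℝ)) μ :=
      hind.comp (fun _ x => inner ℝ a x) (fun _ => measurable_const.inner measurable_id)
    exact measure_linearForm_gt_le hZ (fun i => measurable_const.inner (he i)) hind' hZe'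
      (fun i => hsub i a (hs₂ a ha)) (hf v) (hf1 v) (sqrt_nonneg _)
  have hU : μ (⋃ q ∈ s₁ ×ˢ s₂, A q) ≤ ENNReal.ofReal δ := by
    refine measure_biUnion_le_ofReal _ A (c := 9 ^ D) (exp_pos _).le ?_ hA ?_
    · rw [Finset.card_product, hD, pow_add]
      push_cast
      gcongr
    · rw [hs2, exp_neg, exp_nat_mul, exp_log (by positivity), ← div_eq_mul_inv, ← div_pow,
        div_div_cancel₀ (by norm_num)]
      -- the union bound gives `δ ^ D`
      exact pow_le_of_le_one hδ.le (by linarith) (by omega)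
  refine (measure_mono ?_).trans hU
  intro ω hω
  by_contra hgood
  simp only [Set.mem_iUnion, A, Set.mem_ofPred_eq, not_exists, not_lt] at hgood
  refine hω fun c hc hWc v => ?_
  let M : EuclideanSpace ℝ ι →ₗ[ℝ] EuclideanSpace ℝ κ :=
    { toFun := fun v => ∑ i, W (Z ω) v i • e i ω
      map_add' := fun x y => by simp [add_smul, Finset.sum_add_distrib]
      map_smul' := fun r x => by simp [mul_smul, Finset.smul_sum] }
  have hM : ∀ u ∈ s₁, ‖M u‖ ≤ c * (s * σ) / (1 - 1 / 4) := by
    intro u hu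
    refine norm_le_of_inner_net (by norm_num) hn₂ _ (by positivity) fun a ha => ?_
    have h := hgood (u, a) (Finset.mem_product.2 ⟨hu, ha⟩)
    have h1 : inner ℝ a (M u) = ‖W (Z ω) u‖ * ∑ i, f u i (Z ω) * inner ℝ a (e i ω) := by
      simp only [M, LinearMap.coe_mk, AddHom.coe_mk, inner_sum, real_inner_smul_right,
        Finset.mul_sum, f]
      refine Finset.sum_congr rfl fun i _ => ?_
      rcases eq_or_ne (W (Z ω) u) 0 with h0 | h0
      · simp [h0]
      · have : ‖W (Z ω) u‖ ≠ 0 := norm_ne_zero_iff.2 h0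
        field_simp
    rw [h1]
    have h2 : ‖W (Z ω) u‖ ≤ c := by simpa [hs₁ u hu] using hWc u
    have h3 : 0 ≤ s * σ := mul_nonneg (sqrt_nonneg _) σ.coe_nonneg
    exact (mul_le_mul_of_nonneg_left h (norm_nonneg _)).trans (by gcongr)
  have h := norm_le_of_net M (by norm_num) hn₁ hM v
  refine h.trans ?_
  have h3 : 0 ≤ c * (s * σ) * ‖v‖ := by positivity
  have e1 : c * (s * σ) / (1 - 1 / 4) / (1 - 1 / 4) * ‖v‖ = 16 / 9 * (c * (s * σ) * ‖v‖) := by ring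
  rw [e1]
  nlinarith

end SingularValue

/-! ### The error of the least-squares gain -/

section LeastSquares

open scoped Matrix MatrixOrder Matrix.Norms.L2Operator

variable {ι κ ν : Type*} [Fintype ι] [DecidableEq ι] [Fintype κ] [DecidableEq κ]
  [Fintype ν] [DecidableEq ν]

theorem toEuclideanLin_mul_apply (A : Matrix κ ν ℝ) (B : Matrix ν ι ℝ) (x : EuclideanSpace ℝ ι) :
    (A * B).toEuclideanLin x = A.toEuclideanLin (B.toEuclideanLin x) := by
  simp [Matrix.toLpLin_apply]

theorem inner_toEuclideanLin (A : Matrix κ ι ℝ) (y : EuclideanSpace ℝ κ)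
    (x : EuclideanSpace ℝ ι) :
    inner ℝ y (A.toEuclideanLin x) = inner ℝ (Aᵀ.toEuclideanLin y) x := by
  simp only [Matrix.toLpLin_apply, EuclideanSpace.inner_eq_star_dotProduct, star_trivial]
  rw [Matrix.mulVec_transpose, dotProduct_comm, Matrix.dotProduct_mulVec, dotProduct_comm]

theorem norm_sq_eq_inner_gram (B : Matrix ν ι ℝ) (x : EuclideanSpace ℝ ι) :
    ‖B.toEuclideanLin x‖ ^ 2 = inner ℝ ((Bᵀ * B).toEuclideanLin x) x := by
  rw [← real_inner_self_eq_norm_sq, inner_toEuclideanLin, toEuclideanLin_mul_apply]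

theorem isUnit_gram_of_bounded_below (B : Matrix ν ι ℝ) {c : ℝ} (hc : 0 < c)
    (h : ∀ v, c * ‖v‖ ≤ ‖B.toEuclideanLin v‖) : IsUnit (Bᵀ * B).det := by
  rw [← Matrix.isUnit_iff_isUnit_det, ← Matrix.mulVec_injective_iff_isUnit,
    ← Matrix.coe_mulVecLin, ← LinearMap.ker_eq_bot, LinearMap.ker_eq_bot']
  intro x hx
  have h1 := norm_sq_eq_inner_gram B (WithLp.toLp 2 x)
  rw [show (Bᵀ * B).toEuclideanLin (WithLp.toLp 2 x) = 0 from
    congrArg (WithLp.toLp 2) hx, inner_zero_left] at h1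
  have h2 := h (WithLp.toLp 2 x)
  rw [pow_eq_zero_iff (two_ne_zero)] at h1
  rw [h1] at h2
  have h3 : ‖(WithLp.toLp 2 x : EuclideanSpace ℝ ι)‖ = 0 :=
    le_antisymm (by by_contra! hpos; nlinarith) (norm_nonneg _)
  simpa using h3

theorem norm_rightInverse_le (B : Matrix ν ι ℝ) {c : ℝ} (hc : 0 < c)
    (h : ∀ v, c * ‖v‖ ≤ ‖B.toEuclideanLin v‖) (v : EuclideanSpace ℝ ι) :
    ‖(B * (Bᵀ * B)⁻¹).toEuclideanLin v‖ ≤ c⁻¹ * ‖v‖ := by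
  have hu := isUnit_gram_of_bounded_below B hc h
  rw [toEuclideanLin_mul_apply]
  set q := (Bᵀ * B)⁻¹.toEuclideanLin v with hq
  have h1 : ‖B.toEuclideanLin q‖ ^ 2 ≤ ‖v‖ * ‖q‖ := by
    rw [norm_sq_eq_inner_gram, hq, ← toEuclideanLin_mul_apply, Matrix.mul_nonsing_inv _ hu]
    simpa using real_inner_le_norm v _
  have h2 := h q
  rw [inv_mul_eq_div, le_div_iff₀ hc]
  by_contra! hlt
  have h0 : 0 < ‖B.toEuclideanLin q‖ := by
    by_contra! h0
    nlinarith [norm_nonneg v]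
  nlinarith [norm_nonneg v, norm_nonneg q]

theorem pinv_eq_of_isUnit (Z : Matrix ι ν ℝ) (h : IsUnit (Z * Zᵀ).det) :
    pinv Z = Zᵀ * (Z * Zᵀ)⁻¹ ∧ Z * pinv Z = 1 := by
  have h1 : Z * pinv Z = 1 := by
    have h2 := congrArg (· * (Zᵀ * (Z * Zᵀ)⁻¹)) (mul_pinv_mul Z)
    simp only [Matrix.mul_assoc] at h2
    rw [← Matrix.mul_assoc Z Zᵀ, Matrix.mul_nonsing_inv _ h, Matrix.mul_one] at h2
    exact h2
  refine ⟨?_, h1⟩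
  have h3 : (Z * Zᵀ) * cfc (fun x : ℝ => x⁻¹) (Z * Zᵀ) = 1 := by
    rw [← h1, pinv, Matrix.mul_assoc]
  rw [pinv, ← Matrix.inv_eq_right_inv h3]

theorem measurable_matrix_inv_entry {𝓩 : Type*} [MeasurableSpace 𝓩] {A : 𝓩 → Matrix ι ι ℝ}
    (hA : ∀ i j, Measurable fun z => A z i j) (i j : ι) :
    Measurable fun z => (A z)⁻¹ i j := by
  have hpi : Measurable fun z => (fun i j => A z i j : ι → ι → ℝ) :=
    measurable_pi_lambda _ fun i => measurable_pi_lambda _ fun j => hA i j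
  have h1 : Continuous fun a : ι → ι → ℝ => (Matrix.of a).det := by
    exact Continuous.matrix_det continuous_id
  have h2 : Continuous fun a : ι → ι → ℝ => (Matrix.of a).adjugate i j := by
    have : Continuous fun a : ι → ι → ℝ => (Matrix.of a).adjugate :=
      Continuous.matrix_adjugate (A := fun a : ι → ι → ℝ => Matrix.of a) continuous_id
    exact this.matrix_elem i j
  have h3 : (fun z => (A z)⁻¹ i j) = fun z => ((A z).det)⁻¹ * (A z).adjugate i j := by
    ext z
    simp [Matrix.inv_def]
  rw [h3]
  exact (h1.measurable.comp hpi).inv.mul (h2.measurable.comp hpi)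

variable {Ω : Type*} [MeasurableSpace Ω] {μ : Measure Ω} {N : ℕ}

/-- The matrix with given columns. -/
def columns {N : ℕ} (z : Fin N → EuclideanSpace ℝ ι) : Matrix ι (Fin N) ℝ :=
  Matrix.of fun k i => z i k

theorem toEuclideanLin_columns_transpose (z : Fin N → EuclideanSpace ℝ ι)
    (b : EuclideanSpace ℝ ι) (i : Fin N) :
    (columns z)ᵀ.toEuclideanLin b i = inner ℝ b (z i) := by
  simp [Matrix.toLpLin_apply, Matrix.mulVec, columns, dotProduct, PiLp.inner_apply]

theorem toEuclideanLin_columns (z : Fin N → EuclideanSpace ℝ ι)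
    (w : EuclideanSpace ℝ (Fin N)) :
    (columns z).toEuclideanLin w = ∑ i, w i • z i := by
  ext k
  simp [Matrix.toLpLin_apply, Matrix.mulVec, columns, dotProduct, mul_comm]

/-- If the regressors `Z i` are Gaussian with covariance `R⁻²` and the noise vectors `E i` are
sub-Gaussian and independent of them, then `E Z†` is small. The proof whitens the regressors:
with `B = Zᵀ R`, whose entries are standard Gaussian, `Z† = B (Bᵀ B)⁻¹ R`. -/
theorem measure_noise_mul_pinv_le [IsProbabilityMeasure μ]
    {Z : Fin N → Ω → EuclideanSpace ℝ ι} {E : Fin N → Ω → EuclideanSpace ℝ κ}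
    (hZm : ∀ i, Measurable (Z i)) (hEm : ∀ i, Measurable (E i))
    (hZ : iIndepFun Z μ) (hE : iIndepFun E μ)
    (hZE : IndepFun (fun ω i => Z i ω) (fun ω i => E i ω) μ)
    {R : Matrix ι ι ℝ} (hR : Rᵀ = R) (hRu : IsUnit R.det)
    (hZlaw : ∀ v, ‖v‖ = 1 → ∀ i, μ.map (fun ω => inner ℝ (R.toEuclideanLin v) (Z i ω))
      = gaussianReal 0 1)
    {σ : NNReal}
    (hEsub : ∀ i a, ‖a‖ = 1 → HasSubgaussianMGF (fun ω => inner ℝ a (E i ω)) (σ ^ 2) μ)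
    {δ : ℝ} (hδ : 0 < δ) (hδ' : δ ≤ 1 / 2) (hdim : 1 ≤ Fintype.card ι + Fintype.card κ)
    (hN : 8 * (Fintype.card ι : ℝ) + 16 * Real.log (1 / δ) ≤ N) :
    μ {ω | ¬ (columns (fun i => Z i ω) * pinv (columns fun i => Z i ω) = 1 ∧
        ∀ x, ‖(columns (fun i => E i ω) * pinv (columns fun i => Z i ω)).toEuclideanLin x‖
          ≤ 16 * ‖R‖ * σ
            * √((Fintype.card ι + Fintype.card κ) * Real.log (9 / δ)) / √N * ‖x‖)}
      ≤ ENNReal.ofReal (2 * δ) := by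
  let B : (Fin N → EuclideanSpace ℝ ι) → Matrix (Fin N) ι ℝ := fun z => (columns z)ᵀ * R
  let W : (Fin N → EuclideanSpace ℝ ι) → EuclideanSpace ℝ ι →ₗ[ℝ] EuclideanSpace ℝ (Fin N) :=
    fun z => (B z * ((B z)ᵀ * B z)⁻¹).toEuclideanLin
  have hBm : ∀ i k, Measurable fun z => B z i k := fun i k => by
    simp only [B, Matrix.mul_apply, columns, Matrix.transpose_apply, Matrix.of_apply]
    fun_prop
  have hWm : ∀ v i, Measurable fun z => W z v i := fun v i => by
    have hinv := fun k l => measurable_matrix_inv_entry (A := fun z => (B z)ᵀ * B z)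
      (fun k l => by
        simp only [Matrix.mul_apply, Matrix.transpose_apply]
        exact Finset.measurable_sum _ fun j _ => (hBm j k).mul (hBm j l)) k l
    simp only [W, Matrix.toLpLin_apply, Matrix.mulVec, dotProduct, Matrix.mul_apply]
    exact Finset.measurable_sum _ fun l _ => Measurable.mul_const
      (Finset.measurable_sum _ fun k _ => (hBm i k).mul (hinv k l)) _
  have hBv : ∀ z v i, (B z).toEuclideanLin v i = inner ℝ (R.toEuclideanLin v) (z i) := by
    intro z v i
    rw [toEuclideanLin_mul_apply, toEuclideanLin_columns_transpose]
  have h1 := measure_not_bounded_below_le (μ := μ)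
    (fun ω => (B fun i => Z i ω).toEuclideanLin)
    (fun v i => by simp only [hBv]; exact measurable_const.inner (hZm i))
    (fun v => by
      simp only [hBv]
      exact hZ.comp (fun _ x => inner ℝ (R.toEuclideanLin v) x)
        (fun _ => measurable_const.inner measurable_id))
    (fun v hv i => by simp only [hBv]; exact hZlaw v hv i) hδ hδ'
    (by rwa [finrank_euclideanSpace])
  have h2 := measure_product_norm_gt_le (measurable_pi_lambda _ hZm) hEm hE hZE hEsub W hWm
    hδ hδ' hdim
  have hNpos : 0 < (N : ℝ) := by
    have : 0 < Real.log (1 / δ) := Real.log_pos (by rw [lt_div_iff₀ hδ]; linarith)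
    have : (0 : ℝ) ≤ Fintype.card ι := by positivity
    linarith
  refine (measure_mono fun ω hω => ?_).trans ((measure_union_le _ _).trans
    ((add_le_add h1 h2).trans_eq ?_))
  swap
  · rw [← ENNReal.ofReal_add hδ.le hδ.le, two_mul]
  by_contra hgood
  simp only [Set.mem_union, Set.mem_ofPred_eq, not_or, not_not] at hgood hω
  obtain ⟨hg1, hg2⟩ := hgood
  set z := fun i => Z i ω with hz
  have hc : 0 < √(N : ℝ) / 5 := by positivity
  have hu := isUnit_gram_of_bounded_below (B z) hc hg1
  have hgram : (B z)ᵀ * B z = R * (columns z * (columns z)ᵀ) * R := by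
    simp only [B, Matrix.transpose_mul, Matrix.transpose_transpose, hR, Matrix.mul_assoc]
  have hZu : IsUnit (columns z * (columns z)ᵀ).det := by
    rw [hgram, Matrix.det_mul, Matrix.det_mul] at hu
    exact isUnit_of_mul_isUnit_right (isUnit_of_mul_isUnit_left hu)
  obtain ⟨hp, hp1⟩ := pinv_eq_of_isUnit (columns z) hZu
  have hpW : pinv (columns z) = B z * ((B z)ᵀ * B z)⁻¹ * R := by
    rw [hp, hgram, Matrix.mul_inv_rev, Matrix.mul_inv_rev]
    simp only [B, Matrix.mul_assoc]
    rw [Matrix.nonsing_inv_mul _ hRu, Matrix.mul_one, ← Matrix.mul_assoc R R⁻¹,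
      Matrix.mul_nonsing_inv _ hRu, Matrix.one_mul]
  refine hω ⟨hp1, fun x => ?_⟩
  have h3 := hg2 (√(N : ℝ) / 5)⁻¹ (by positivity) (norm_rightInverse_le (B z) hc hg1)
    (R.toEuclideanLin x)
  have h4 : (columns (fun i => E i ω) * pinv (columns z)).toEuclideanLin x
      = ∑ i, W z (R.toEuclideanLin x) i • E i ω := by
    rw [hpW, ← Matrix.mul_assoc, toEuclideanLin_mul_apply, toEuclideanLin_mul_apply,
      toEuclideanLin_columns]
  have h5 : ‖R.toEuclideanLin x‖ ≤ ‖R‖ * ‖x‖ := Matrix.l2_opNorm_mulVec R x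
  rw [h4]
  refine h3.trans ?_
  set q := √((Fintype.card ι + Fintype.card κ) * Real.log (9 / δ)) with hq
  -- the constant is `10 √2 ≤ 16`
  have h6 : √(2 * ((Fintype.card ι + Fintype.card κ) * Real.log (9 / δ))) ≤ 8 / 5 * q := by
    rw [Real.sqrt_mul (by norm_num)]
    gcongr
    exact Real.sqrt_le_iff.2 ⟨by norm_num, by norm_num⟩
  calc 2 * (√(N : ℝ) / 5)⁻¹ * √(2 * ((Fintype.card ι + Fintype.card κ) * Real.log (9 / δ))) * σ
        * ‖R.toEuclideanLin x‖
      ≤ 2 * (√(N : ℝ) / 5)⁻¹ * (8 / 5 * q) * σ * (‖R‖ * ‖x‖) := by gcongr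
    _ = 16 * ‖R‖ * σ * q / √N * ‖x‖ := by
      rw [inv_div]; ring

end LeastSquares

/-! ### Independence -/

section Independence

variable {Ω : Type*} [mΩ : MeasurableSpace Ω] {μ : Measure Ω}

/-- If `m₃` is independent of `m₁ ⊔ m₂`, and `m₁` is independent of `m₂`, then `m₁` is independent
of `m₃ ⊔ m₂`. -/
theorem indep_sup_right_of_indep [IsProbabilityMeasure μ] {m₁ m₂ m₃ : MeasurableSpace Ω}
    (h₁ : m₁ ≤ mΩ) (h₂ : m₂ ≤ mΩ) (h₃ : m₃ ≤ mΩ) (h₁₂ : Indep m₁ m₂ μ)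
    (h : Indep m₃ (m₁ ⊔ m₂) μ) : Indep m₁ (m₃ ⊔ m₂) μ := by
  let p : Set (Set Ω) := {u | ∃ s t, MeasurableSet[m₃] s ∧ MeasurableSet[m₂] t ∧ u = s ∩ t}
  have hp : IsPiSystem p := by
    rintro _ ⟨s, t, hs, ht, rfl⟩ _ ⟨s', t', hs', ht', rfl⟩ -
    exact ⟨s ∩ s', t ∩ t', hs.inter hs', ht.inter ht', Set.inter_inter_inter_comm _ _ _ _⟩
  have hgen : m₃ ⊔ m₂ = MeasurableSpace.generateFrom p := by
    apply le_antisymm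
    · refine sup_le (fun s hs => ?_) (fun t ht => ?_)
      · exact MeasurableSpace.measurableSet_generateFrom
          ⟨s, Set.univ, hs, MeasurableSet.univ, by simp⟩
      · exact MeasurableSpace.measurableSet_generateFrom
          ⟨Set.univ, t, MeasurableSet.univ, ht, by simp⟩
    · refine MeasurableSpace.generateFrom_le ?_
      rintro _ ⟨s, t, hs, ht, rfl⟩
      exact MeasurableSet.inter ((le_sup_left : m₃ ≤ m₃ ⊔ m₂) s hs)
        ((le_sup_right : m₂ ≤ m₃ ⊔ m₂) t ht)
  refine IndepSets.indep h₁ (sup_le h₃ h₂) (@MeasurableSpace.isPiSystem_measurableSet _ m₁) hp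
    (@MeasurableSpace.generateFrom_measurableSet _ m₁).symm hgen ?_
  rw [IndepSets_iff]
  rintro r _ hr ⟨s, t, hs, ht, rfl⟩
  have hrt : MeasurableSet[m₁ ⊔ m₂] (r ∩ t) :=
    MeasurableSet.inter ((le_sup_left : m₁ ≤ m₁ ⊔ m₂) r hr) ((le_sup_right : m₂ ≤ m₁ ⊔ m₂) t ht)
  have e1 := (Indep_iff _ _ _).1 h s (r ∩ t) hs hrt
  have e2 := (Indep_iff _ _ _).1 h s t hs ((le_sup_right : m₂ ≤ m₁ ⊔ m₂) t ht)
  have e3 := (Indep_iff _ _ _).1 h₁₂ r t hr ht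
  rw [show r ∩ (s ∩ t) = s ∩ (r ∩ t) from Set.inter_left_comm _ _ _, e1, e2, e3]
  ring

/-- The families obtained by grouping an independent family of variables are independent. -/
theorem iIndepFun_curry {ι κ : Type*} {𝓧 : ι → κ → Type*} [∀ i j, MeasurableSpace (𝓧 i j)]
    {X : (i : ι) → (j : κ) → Ω → 𝓧 i j} (hX : ∀ i j, Measurable (X i j))
    (h : iIndepFun (fun (q : ι × κ) ω => X q.1 q.2 ω) μ) :
    iIndepFun (fun i ω j => X i j ω) μ := by
  have := h.isProbabilityMeasure
  have hσ : iIndepFun (fun (q : (_ : ι) × κ) ω => X q.1 q.2 ω) μ :=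
    h.precomp (Equiv.sigmaEquivProd ι κ).injective
  have hP : ∀ i j, IsProbabilityMeasure (μ.map (X i j)) := fun i j =>
    Measure.isProbabilityMeasure_map (hX i j).aemeasurable
  have h1 := (iIndepFun_iff_map_fun_eq_infinitePi_map (fun q => hX q.1 q.2)).1 hσ
  have h2 := congrArg (Measure.map (MeasurableEquiv.piCurry (fun i (j : κ) => 𝓧 i j))) h1
  rw [Measure.infinitePi_map_piCurry (fun i j => μ.map (X i j)),
    Measure.map_map (by fun_prop) (measurable_pi_lambda _ fun q => hX q.1 q.2)] at h2
  have hm : ∀ i, Measurable fun ω j => X i j ω := fun i => measurable_pi_lambda _ (hX i)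
  rw [iIndepFun_iff_map_fun_eq_infinitePi_map hm]
  refine Eq.trans h2 ?_
  congr 1
  ext1 i
  have hi : iIndepFun (X i) μ := h.precomp (g := fun j => (i, j)) (Prod.mk_right_injective i)
  exact ((iIndepFun_iff_map_fun_eq_infinitePi_map (hX i)).1 hi).symm

end Independence

/-! ### Linear regression and minimum mean square error -/

section Regression

variable {Ω : Type*} [MeasurableSpace Ω] {μ : Measure Ω}

/-- The coefficients of the orthogonal projection in `L²` of the `X k` to the span of the `Y i`. -/
theorem exists_regression_coeff [IsProbabilityMeasure μ] {ι κ : Type*} [Fintype ι]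
    (X : κ → Ω → ℝ) (Y : ι → Ω → ℝ) (hX : ∀ k, MemLp (X k) 2 μ) (hY : ∀ i, MemLp (Y i) 2 μ)
    (hY0 : ∀ i, ∫ ω, Y i ω ∂μ = 0) :
    ∃ K : κ → ι → ℝ, ∀ k j, covariance (fun ω => X k ω - ∑ i, K k i * Y i ω) (Y j) μ = 0 := by
  let y : ι → Lp ℝ 2 μ := fun i => (hY i).toLp
  let V : Submodule ℝ (Lp ℝ 2 μ) := Submodule.span ℝ (Set.range y)
  have : FiniteDimensional ℝ V := FiniteDimensional.span_of_finite ℝ (Set.finite_range y)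
  have hk : ∀ k, ∃ c : ι → ℝ, ∑ i, c i • y i = V.starProjection (hX k).toLp := fun k =>
    (Submodule.mem_span_range_iff_exists_fun ℝ).1 (V.starProjection_apply_mem _)
  choose K hK using hk
  refine ⟨K, fun k j => ?_⟩
  have hmem : MemLp (fun ω => X k ω - ∑ i, K k i * Y i ω) 2 μ :=
    (hX k).sub (memLp_finsetSum _ fun i _ => (hY i).const_mul _)
  have horth : inner ℝ ((hX k).toLp - V.starProjection (hX k).toLp) (y j) = 0 :=
    (Submodule.mem_orthogonal' _ _).1 (V.sub_starProjection_mem_orthogonal _) _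
      (Submodule.subset_span ⟨j, rfl⟩)
  have hlp : (hX k).toLp - V.starProjection (hX k).toLp = hmem.toLp := by
    have hs : ∀ s : Finset ι, ∑ i ∈ s, K k i • y i
        = (memLp_finsetSum s fun i _ => (hY i).const_mul (K k i)).toLp := by
      classical
      intro s
      induction s using Finset.induction_on with
      | empty => simp only [Finset.sum_empty]; rfl
      | insert i s hi ih =>
        rw [Finset.sum_insert hi, ih]
        simp only [Finset.sum_insert hi]
        rfl
    rw [← hK k, hs]
    rfl
  rw [hlp, L2.inner_def] at horth
  rw [covariance_eq_sub hmem (hY j), hY0 j, mul_zero, sub_zero, ← horth]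
  refine integral_congr_ae ?_
  filter_upwards [hmem.coeFn_toLp, (hY j).coeFn_toLp] with ω h1 h2
  simp only [y, RCLike.inner_apply, conj_trivial, Pi.mul_apply]
  rw [h1, h2, mul_comm]

theorem lintegral_enorm_sq_eq {F : Type*} [NormedAddCommGroup F] {f : Ω → F}
    (hf : MemLp f 2 μ) : ∫⁻ ω, ‖f ω‖ₑ ^ 2 ∂μ = ENNReal.ofReal (∫ ω, ‖f ω‖ ^ 2 ∂μ) := by
  rw [ofReal_integral_eq_lintegral_ofReal (hf.integrable_norm_pow two_ne_zero)
    (.of_forall fun _ => by positivity)]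
  refine lintegral_congr fun ω => ?_
  rw [ENNReal.ofReal_pow (norm_nonneg _), ofReal_norm]

/-- If `X = φ(Z) + e` with `e` centred and independent of `Z`, then `φ(Z)` is the only function of
`Z`, up to null sets, with the least mean square error. -/
theorem ae_eq_of_minimizes [IsProbabilityMeasure μ] {ι 𝓩 : Type*} [Fintype ι] [MeasurableSpace 𝓩]
    {Z : Ω → 𝓩} (hZ : Measurable Z) {e X : Ω → EuclideanSpace ℝ ι} (he : Measurable e)
    (he2 : MemLp e 2 μ) (he0 : ∀ i, ∫ ω, e ω i ∂μ = 0) (hind : IndepFun e Z μ)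
    {φ g : 𝓩 → EuclideanSpace ℝ ι} (hφ : Measurable φ) (hg : Measurable g)
    (hX : ∀ ω, X ω = φ (Z ω) + e ω)
    (hmin : ∫⁻ ω, ‖X ω - g (Z ω)‖ₑ ^ 2 ∂μ ≤ ∫⁻ ω, ‖X ω - φ (Z ω)‖ₑ ^ 2 ∂μ) :
    ∀ᵐ ω ∂μ, g (Z ω) = φ (Z ω) := by
  let h : Ω → EuclideanSpace ℝ ι := fun ω => φ (Z ω) - g (Z ω)
  have hhm : Measurable h := (hφ.comp hZ).sub (hg.comp hZ)
  have e1 : ∀ ω, X ω - g (Z ω) = e ω + h ω := fun ω => by rw [hX]; simp only [h]; abel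
  have e2 : ∀ ω, X ω - φ (Z ω) = e ω := fun ω => by rw [hX]; abel
  simp only [e1, e2] at hmin
  have hsum : MemLp (fun ω => e ω + h ω) 2 μ := by
    refine ⟨(he.add hhm).aestronglyMeasurable, ?_⟩
    rw [eLpNorm_lt_top_iff_lintegral_rpow_enorm_lt_top (by norm_num) (by norm_num)]
    simp only [ENNReal.toReal_ofNat, ENNReal.rpow_ofNat]
    refine hmin.trans_lt ?_
    rw [lintegral_enorm_sq_eq he2]
    exact ENNReal.ofReal_lt_top
  have hh2 : MemLp h 2 μ := by
    have := hsum.sub he2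
    refine this.congr_norm hhm.aestronglyMeasurable (.of_forall fun ω => ?_)
    simp
  have hei : ∀ i, MemLp (fun ω => e ω i) 2 μ := fun i => he2.eval_piLp i
  have hhi : ∀ i, MemLp (fun ω => h ω i) 2 μ := fun i => hh2.eval_piLp i
  have hprod : ∀ i, Integrable (fun ω => h ω i * e ω i) μ := fun i => (hhi i).integrable_mul (hei i)
  have hinner : ∀ ω, (inner ℝ (e ω) (h ω) : ℝ) = ∑ i, h ω i * e ω i := fun ω => by
    simp [PiLp.inner_apply]
  have hcross : ∫ ω, (inner ℝ (e ω) (h ω) : ℝ) ∂μ = 0 := by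
    have hi : ∀ i, IndepFun (fun ω => e ω i) (fun ω => h ω i) μ := fun i =>
      hind.comp (φ := fun x : EuclideanSpace ℝ ι => x i) (ψ := fun z => (φ z - g z) i)
        (by fun_prop) (by fun_prop)
    rw [integral_congr_ae (.of_forall hinner), integral_finsetSum _ fun i _ => hprod i]
    refine Finset.sum_eq_zero fun i _ => ?_
    rw [(hi i).symm.integral_fun_mul_eq_mul_integral (hhi i).1 (hei i).1, he0 i, mul_zero]
  rw [lintegral_enorm_sq_eq hsum, lintegral_enorm_sq_eq he2,
    ENNReal.ofReal_le_ofReal_iff (integral_nonneg fun _ => by positivity)] at hmin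
  have hexp : ∫ ω, ‖e ω + h ω‖ ^ 2 ∂μ = ∫ ω, ‖e ω‖ ^ 2 ∂μ + ∫ ω, ‖h ω‖ ^ 2 ∂μ := by
    have hin : Integrable (fun ω => (inner ℝ (e ω) (h ω) : ℝ)) μ :=
      (integrable_finsetSum Finset.univ fun i _ => hprod i).congr (.of_forall fun ω =>
        (hinner ω).symm)
    simp only [norm_add_sq_real]
    rw [integral_add, integral_add, integral_const_mul, hcross]
    · ring
    · exact he2.integrable_norm_pow two_ne_zero
    · exact hin.const_mul 2
    · exact (he2.integrable_norm_pow two_ne_zero).add (hin.const_mul 2)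
    · exact hh2.integrable_norm_pow two_ne_zero
  have hzero : ∫ ω, ‖h ω‖ ^ 2 ∂μ = 0 :=
    le_antisymm (by linarith) (integral_nonneg fun _ => by positivity)
  rw [integral_eq_zero_iff_of_nonneg (fun _ => by positivity)
    (hh2.integrable_norm_pow two_ne_zero)] at hzero
  filter_upwards [hzero] with ω hω
  have h0 : h ω = 0 := by simpa using hω
  exact (sub_eq_zero.1 h0).symm

end Regression

/-! ### Superposition of the free and the forced response -/

section Response

variable {n m p : ℕ} {Ω : Type*}

instance (T : ℕ) : Finite (NoiseSource T) := by
  let f : NoiseSource T → Unit ⊕ Fin T ⊕ Fin (T + 1)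
    | .init => .inl ()
    | .process s => .inr (.inl s)
    | .measurement s => .inr (.inr s)
  refine Finite.of_injective f fun a b h => ?_
  cases a <;> cases b <;> simp_all [f]

noncomputable instance (T : ℕ) : Fintype (NoiseSource T) := Fintype.ofFinite _

/-- A family of continuous linear functionals as a map into Euclidean space. -/
noncomputable def euclideanPi {ι W : Type*} [Fintype ι] [NormedAddCommGroup W] [NormedSpace ℝ W]
    (f : ι → W →L[ℝ] ℝ) : W →L[ℝ] EuclideanSpace ℝ ι :=
  (EuclideanSpace.equiv ι ℝ).symm.toContinuousLinearMap ∘L ContinuousLinearMap.pi f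

@[simp]
theorem euclideanPi_apply {ι W : Type*} [Fintype ι] [NormedAddCommGroup W] [NormedSpace ℝ W]
    (f : ι → W →L[ℝ] ℝ) (w : W) (i : ι) : euclideanPi f w i = f i w := rfl

/-- The continuous linear map of a matrix. -/
noncomputable abbrev matrixCLM {ι κ : Type*} [Fintype ι] [DecidableEq ι] [Fintype κ]
    (A : Matrix κ ι ℝ) :
    EuclideanSpace ℝ ι →L[ℝ] EuclideanSpace ℝ κ :=
  LinearMap.toContinuousLinearMap A.toEuclideanLin

/-- The states of the system as linear functions of a parameter `ξ ∈ W`, if the initial state, the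
inputs and the process noises are linear functions of `ξ`. -/
noncomputable def stateMap (S : LinearSystem n m p) {W : Type*} [NormedAddCommGroup W]
    [NormedSpace ℝ W] (x₀ : W →L[ℝ] EuclideanSpace ℝ (Fin n))
    (u : ℕ → W →L[ℝ] EuclideanSpace ℝ (Fin m)) (w : ℕ → W →L[ℝ] EuclideanSpace ℝ (Fin n)) :
    ℕ → W →L[ℝ] EuclideanSpace ℝ (Fin n)
  | 0 => x₀
  | s + 1 => matrixCLM S.A ∘L stateMap S x₀ u w s + matrixCLM S.B ∘L u s + w s

/-- The values of the noise sources of a run with horizon `T`. -/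
abbrev NoiseVec (n p T : ℕ) : Type := (k : NoiseSource T) → EuclideanSpace ℝ (Fin (k.dim n p))

/-- The initial state as a function of the noise vector. -/
noncomputable def initProj (n p T : ℕ) : NoiseVec n p T →L[ℝ] EuclideanSpace ℝ (Fin n) :=
  ContinuousLinearMap.proj (R := ℝ)
    (φ := fun k : NoiseSource T => EuclideanSpace ℝ (Fin (k.dim n p))) .init

/-- The process noise `w(s)` as a function of the noise vector. -/
noncomputable def processProj (n p : ℕ) {T : ℕ} (s : Fin T) :
    NoiseVec n p T →L[ℝ] EuclideanSpace ℝ (Fin n) :=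
  ContinuousLinearMap.proj (R := ℝ)
    (φ := fun k : NoiseSource T => EuclideanSpace ℝ (Fin (k.dim n p))) (.process s)

/-- The measurement noise `v(s)` as a function of the noise vector. -/
noncomputable def measurementProj (n p : ℕ) {T : ℕ} (s : Fin (T + 1)) :
    NoiseVec n p T →L[ℝ] EuclideanSpace ℝ (Fin p) :=
  ContinuousLinearMap.proj (R := ℝ)
    (φ := fun k : NoiseSource T => EuclideanSpace ℝ (Fin (k.dim n p))) (.measurement s)

/-- The state at time `s` of the system without inputs, as a function of the noise. -/
noncomputable def freeState (S : LinearSystem n m p) (T : ℕ) :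
    ℕ → NoiseVec n p T →L[ℝ] EuclideanSpace ℝ (Fin n) :=
  stateMap S (initProj n p T) (fun _ => 0)
    fun s => if h : s < T then processProj n p ⟨s, h⟩ else 0

/-- The output at time `s` of the system without inputs, as a function of the noise. -/
noncomputable def freeOutput (S : LinearSystem n m p) (T s : ℕ) :
    NoiseVec n p T →L[ℝ] EuclideanSpace ℝ (Fin p) :=
  matrixCLM S.C ∘L freeState S T s + if h : s < T + 1 then measurementProj n p ⟨s, h⟩ else 0

/-- The outputs up to time `t` of the system without inputs, as a function of the noise. -/
noncomputable def freeOutputs (S : LinearSystem n m p) (T t : ℕ) :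
    NoiseVec n p T →L[ℝ] EuclideanSpace ℝ (Fin (t + 1) × Fin p) :=
  euclideanPi fun q => EuclideanSpace.proj q.2 ∘L freeOutput S T q.1

/-- The input `u(s)` as a function of the past `[u(0); …; u(t-1); y(0); …; y(t)]`. -/
noncomputable def pastInput (m p t s : ℕ) :
    EuclideanSpace ℝ (PastIndex m p t) →L[ℝ] EuclideanSpace ℝ (Fin m) :=
  if h : s < t then euclideanPi fun j => EuclideanSpace.proj (Sum.inl (⟨s, h⟩, j)) else 0

/-- The state at time `s` which is due to the inputs, as a function of the past. -/
noncomputable def forcedState (S : LinearSystem n m p) (t : ℕ) :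
    ℕ → EuclideanSpace ℝ (PastIndex m p t) →L[ℝ] EuclideanSpace ℝ (Fin n) :=
  stateMap S 0 (pastInput m p t) fun _ => 0

/-- The part of the outputs which is not due to the inputs, as a function of the past. -/
noncomputable def unforcedOutputs (S : LinearSystem n m p) (t : ℕ) :
    EuclideanSpace ℝ (PastIndex m p t) →L[ℝ] EuclideanSpace ℝ (Fin (t + 1) × Fin p) :=
  euclideanPi fun q => EuclideanSpace.proj (Sum.inr q)
    - EuclideanSpace.proj q.2 ∘L matrixCLM S.C ∘L forcedState S t q.1

/-- The noise of a run. -/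
def Trajectory.noiseVec (τ : Trajectory n m p Ω) (T : ℕ) (ω : Ω) : NoiseVec n p T :=
  fun k => τ.noise k ω

variable {S : LinearSystem n m p} {T t : ℕ} {τ : Trajectory n m p Ω}

theorem Trajectory.Follows.state_eq (h : τ.Follows S T) (ht : t ≤ T) (ω : Ω) {s : ℕ} (hs : s ≤ t) :
    τ.x s ω = freeState S T s (τ.noiseVec T ω) + forcedState S t s (τ.past t ω) := by
  induction s with
  | zero =>
    simp only [freeState, forcedState, stateMap, zero_apply, add_zero]
    rfl
  | succ s ih =>
    have hsT : s < T := by omega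
    have hst : s < t := by omega
    have hw : processProj n p ⟨s, hsT⟩ (τ.noiseVec T ω) = τ.w s ω := rfl
    have hu : pastInput m p t s (τ.past t ω) = τ.u s ω := by
      rw [pastInput, dif_pos hst]; rfl
    rw [h.1 s hsT ω, ih (by omega)]
    simp only [freeState, forcedState, stateMap] at *
    simp only [add_apply, ContinuousLinearMap.comp_apply,
      zero_apply, map_add, map_zero, dif_pos hsT, hw, hu,
      LinearMap.coe_toContinuousLinearMap']
    abel

theorem Trajectory.Follows.freeOutputs_eq (h : τ.Follows S T) (ht : t ≤ T) (ω : Ω) :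
    freeOutputs S T t (τ.noiseVec T ω) = unforcedOutputs S t (τ.past t ω) := by
  ext q
  have hq : (q.1 : ℕ) ≤ t := Nat.lt_succ_iff.1 q.1.2
  have hqT : (q.1 : ℕ) < T + 1 := by omega
  have hv : measurementProj n p ⟨q.1, hqT⟩ (τ.noiseVec T ω) = τ.v q.1 ω := rfl
  have hy : (EuclideanSpace.proj (𝕜 := ℝ) (Sum.inr q) : _ →L[ℝ] ℝ) (τ.past t ω)
      = τ.y q.1 ω q.2 := rfl
  simp only [freeOutputs, unforcedOutputs, euclideanPi_apply, sub_apply,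
    ContinuousLinearMap.comp_apply, hy, h.2 _ (by omega : (q.1 : ℕ) ≤ T) ω, freeOutput,
    add_apply, dif_pos hqT, hv, h.state_eq ht ω hq]
  simp [Matrix.toLpLin_apply, Matrix.mulVec_add]
  ring

/-- The gain of the estimator that regresses the free state on the free outputs with gain `K`. -/
noncomputable def estimatorGain (S : LinearSystem n m p) (t : ℕ)
    (K : EuclideanSpace ℝ (Fin (t + 1) × Fin p) →L[ℝ] EuclideanSpace ℝ (Fin n)) :
    EuclideanSpace ℝ (PastIndex m p t) →L[ℝ] EuclideanSpace ℝ (Fin n) :=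
  K ∘L unforcedOutputs S t + forcedState S t t

/-- The error of the estimator that regresses the free state on the free outputs with gain `K`,
which is a function of the noise only. -/
noncomputable def estimatorError (S : LinearSystem n m p) (T t : ℕ)
    (K : EuclideanSpace ℝ (Fin (t + 1) × Fin p) →L[ℝ] EuclideanSpace ℝ (Fin n)) :
    NoiseVec n p T →L[ℝ] EuclideanSpace ℝ (Fin n) :=
  freeState S T t - K ∘L freeOutputs S T t

theorem Trajectory.Follows.state_eq_estimate_add_error (h : τ.Follows S T) (ht : t ≤ T)
    (K : EuclideanSpace ℝ (Fin (t + 1) × Fin p) →L[ℝ] EuclideanSpace ℝ (Fin n)) (ω : Ω) :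
    τ.x t ω = estimatorGain S t K (τ.past t ω) + estimatorError S T t K (τ.noiseVec T ω) := by
  simp only [estimatorGain, estimatorError, add_apply,
    sub_apply, ContinuousLinearMap.comp_apply, h.freeOutputs_eq ht ω,
    h.state_eq ht ω le_rfl]
  abel

end Response

/-! ### The law of the noise -/

section NoiseLaw

variable {n m p : ℕ}

section GaussianPi

variable {K : Type*} [Fintype K] {dim : K → ℕ}

/-- The law of a family of independent centred Gaussian vectors with given covariances. -/
noncomputable def gaussianPi (C : (k : K) → Matrix (Fin (dim k)) (Fin (dim k)) ℝ) :
    Measure ((k : K) → EuclideanSpace ℝ (Fin (dim k))) :=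
  Measure.pi fun k => multivariateGaussian 0 (C k)

variable (C : (k : K) → Matrix (Fin (dim k)) (Fin (dim k)) ℝ)

instance : IsProbabilityMeasure (gaussianPi C) := by
  unfold gaussianPi; infer_instance

theorem hasGaussianLaw_id_gaussianPi :
    HasGaussianLaw (fun ξ : (k : K) → EuclideanSpace ℝ (Fin (dim k)) => ξ) (gaussianPi C) := by
  have h : iIndepFun (fun (k : K) (ξ : (k : K) → EuclideanSpace ℝ (Fin (dim k))) => ξ k)
      (gaussianPi C) :=
    iIndepFun_pi (X := fun _ x => x) fun k => aemeasurable_id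
  refine h.hasGaussianLaw fun k => ⟨?_⟩
  rw [gaussianPi, (measurePreserving_eval _ k).map_eq]
  infer_instance

theorem integral_gaussianPi (ℓ : ((k : K) → EuclideanSpace ℝ (Fin (dim k))) →L[ℝ] ℝ) :
    ∫ ξ, ℓ ξ ∂(gaussianPi C) = 0 := by
  have hint : Integrable (fun ξ : (k : K) → EuclideanSpace ℝ (Fin (dim k)) => ξ) (gaussianPi C) :=
    (hasGaussianLaw_id_gaussianPi C).integrable
  have h0 : ∫ ξ, ξ ∂(gaussianPi C) = 0 := by
    ext1 k
    rw [eval_integral fun k => hint.eval k]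
    have h := integral_map (μ := gaussianPi C)
      (φ := fun ξ : (k : K) → EuclideanSpace ℝ (Fin (dim k)) => ξ k)
      (f := fun x => x) (measurable_pi_apply k).aemeasurable (by fun_prop)
    rw [← h, gaussianPi, (measurePreserving_eval _ k).map_eq, integral_id_multivariateGaussian]
    rfl
  rw [ℓ.integral_comp_comm hint, h0, map_zero]

theorem map_eq_gaussianPi {Ω : Type*} [MeasurableSpace Ω] {μ : Measure Ω} [IsProbabilityMeasure μ]
    {X : (k : K) → Ω → EuclideanSpace ℝ (Fin (dim k))} (hX : iIndepFun X μ)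
    (hm : ∀ k, Measurable (X k)) (hlaw : ∀ k, μ.map (X k) = multivariateGaussian 0 (C k)) :
    μ.map (fun ω k => X k ω) = gaussianPi C := by
  rw [(iIndepFun_iff_map_fun_eq_pi_map fun k => (hm k).aemeasurable).1 hX]
  simp only [hlaw, gaussianPi]

end GaussianPi

/-- The law of the noise of a run. -/
noncomputable abbrev noiseLaw (S : LinearSystem n m p) (T : ℕ) : Measure (NoiseVec n p T) :=
  gaussianPi (dim := fun k : NoiseSource T => k.dim n p) S.noiseCov

/-- The linear regression of the free state on the free outputs leaves an error which is
independent of the outputs, as all variables are jointly Gaussian. -/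
theorem exists_regression_gain (S : LinearSystem n m p) (T t : ℕ) :
    ∃ K : EuclideanSpace ℝ (Fin (t + 1) × Fin p) →L[ℝ] EuclideanSpace ℝ (Fin n),
      IndepFun (estimatorError S T t K) (freeOutputs S T t) (noiseLaw S T) := by
  have hlin : ∀ ℓ : NoiseVec n p T →L[ℝ] ℝ, MemLp ℓ 2 (noiseLaw S T) := fun ℓ =>
    ((hasGaussianLaw_id_gaussianPi _).map_fun ℓ).memLp_two
  obtain ⟨K, hK⟩ := exists_regression_coeff (μ := noiseLaw S T)
    (fun (k : Fin n) ξ => freeState S T t ξ k) (fun q ξ => freeOutputs S T t ξ q)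
    (fun k => hlin (EuclideanSpace.proj k ∘L freeState S T t))
    (fun q => hlin (EuclideanSpace.proj q ∘L freeOutputs S T t))
    (fun q => integral_gaussianPi _ (EuclideanSpace.proj q ∘L freeOutputs S T t))
  refine ⟨matrixCLM (Matrix.of K), ?_⟩
  set e := estimatorError S T t (matrixCLM (Matrix.of K)) with he
  have hjoint : HasGaussianLaw
      (fun ξ => (fun k => e ξ k, fun q => freeOutputs S T t ξ q)) (noiseLaw S T) :=
    (hasGaussianLaw_id_gaussianPi _).map_fun
      (((EuclideanSpace.equiv _ ℝ).toContinuousLinearMap ∘L e).prod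
        ((EuclideanSpace.equiv _ ℝ).toContinuousLinearMap ∘L freeOutputs S T t))
  have hind := hjoint.indepFun_of_covariance_eval (fun k q => hK k q)
  exact hind.comp (φ := WithLp.toLp 2) (ψ := WithLp.toLp 2) (by fun_prop) (by fun_prop)

/-- All that is known from the past of a run is known from the outputs of the system without inputs
and the information that the inputs are based on. -/
theorem Trajectory.Follows.measurable_past {Ω : Type*} [MeasurableSpace Ω]
    {S : LinearSystem n m p} {T t : ℕ} {τ : Trajectory n m p Ω} (h : τ.Follows S T) (ht : t ≤ T)
    (hfree : Measurable fun ω => freeOutputs S T t (τ.noiseVec T ω))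
    (hcausal : ∀ s < t, (∀ r ≤ s, Measurable (τ.y r)) → Measurable (τ.u s)) :
    Measurable (τ.past t) := by
  have hfree' : ∀ s ≤ t, Measurable fun ω => freeOutput S T s (τ.noiseVec T ω) := by
    intro s hs
    have h2 : Measurable fun c : EuclideanSpace ℝ (Fin (t + 1) × Fin p) =>
        (WithLp.toLp 2 fun j => c (⟨s, by omega⟩, j) : EuclideanSpace ℝ (Fin p)) := by fun_prop
    exact h2.comp hfree
  -- the forced part of the state and the outputs are known if the earlier inputs are
  have hinput : ∀ s, (∀ r < s, Measurable (τ.u r)) → s ≤ t →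
      Measurable (fun ω => forcedState S t s (τ.past t ω)) := by
    intro s
    induction s with
    | zero =>
      intro _ _
      simp only [forcedState, stateMap, zero_apply]
      exact measurable_const
    | succ s ih =>
      intro hu hs
      have h1 := ih (fun r hr => hu r (by omega)) (by omega)
      have e : (fun ω => forcedState S t (s + 1) (τ.past t ω))
          = fun ω => matrixCLM S.A (forcedState S t s (τ.past t ω)) + matrixCLM S.B (τ.u s ω) := by
        ext1 ω
        have hst : s < t := by omega
        have hu' : pastInput m p t s (τ.past t ω) = τ.u s ω := by
          rw [pastInput, dif_pos hst]; rfl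
        simp only [forcedState, stateMap, add_apply, ContinuousLinearMap.comp_apply, add_zero, hu']
      rw [e]
      exact ((matrixCLM S.A).measurable.comp h1).add
        ((matrixCLM S.B).measurable.comp (hu s (by omega)))
  have hout : ∀ s, (∀ r < s, Measurable (τ.u r)) → s ≤ t → Measurable (τ.y s) := by
    intro s hu hs
    have e : τ.y s = fun ω => freeOutput S T s (τ.noiseVec T ω)
        + matrixCLM S.C (forcedState S t s (τ.past t ω)) := by
      ext1 ω
      have hsT : s < T + 1 := by omega
      have hv : measurementProj n p ⟨s, hsT⟩ (τ.noiseVec T ω) = τ.v s ω := rfl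
      rw [h.2 s (by omega) ω, h.state_eq ht ω hs]
      simp only [freeOutput, add_apply, ContinuousLinearMap.comp_apply, dif_pos hsT, hv,
        map_add, LinearMap.coe_toContinuousLinearMap']
      abel
    rw [e]
    exact (hfree' s hs).add ((matrixCLM S.C).measurable.comp (hinput s hu hs))
  have hu : ∀ s, s < t → Measurable (τ.u s) := by
    intro s
    induction s using Nat.strong_induction_on with
    | _ s ih =>
      intro hs
      exact hcausal s hs fun r hr =>
        hout r (fun r' hr' => ih r' (by omega) (by omega)) (by omega)
  have hfun : Measurable fun ω =>
      (Sum.elim (fun k => τ.u k.1 ω k.2) (fun k => τ.y k.1 ω k.2) : PastIndex m p t → ℝ) := by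
    refine measurable_pi_lambda _ fun k => ?_
    rcases k with ⟨s, j⟩ | ⟨s, j⟩
    · have hj : Measurable fun c : EuclideanSpace ℝ (Fin m) => c j := by fun_prop
      exact hj.comp (hu s s.2)
    · have hj : Measurable fun c : EuclideanSpace ℝ (Fin p) => c j := by fun_prop
      have hs : (s : ℕ) ≤ t := Nat.lt_succ_iff.1 s.2
      exact hj.comp (hout s (fun r hr => hu r (by omega)) hs)
  exact (WithLp.measurable_toLp 2 (PastIndex m p t → ℝ)).comp hfun

variable {Ω : Type*} {𝓖 : MeasurableSpace Ω} [mΩ : MeasurableSpace Ω] {μ : Measure Ω}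
  [IsProbabilityMeasure μ] {S : LinearSystem n m p} {T t : ℕ} {τ : Trajectory n m p Ω}

theorem Trajectory.GaussianNoise.measurable_noiseVec (hg : τ.GaussianNoise S T μ) :
    Measurable (τ.noiseVec T) := measurable_pi_lambda _ fun k => (hg k).1

theorem Trajectory.GaussianNoise.map_noiseVec (hg : τ.GaussianNoise S T μ)
    (hind : iIndepFun (fun k : NoiseSource T => τ.noise k) μ) :
    μ.map (τ.noiseVec T) = noiseLaw S T :=
  map_eq_gaussianPi _ hind (fun k => (hg k).1) fun k => (hg k).2

theorem Trajectory.IsCausalRun.measurable_past (h : τ.IsCausalRun 𝓖 S T μ) (ht : t ≤ T) :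
    Measurable[𝓖 ⊔ MeasurableSpace.comap (fun ω => freeOutputs S T t (τ.noiseVec T ω))
      inferInstance] (τ.past t) :=
  @Trajectory.Follows.measurable_past n m p Ω (𝓖 ⊔ MeasurableSpace.comap
    (fun ω => freeOutputs S T t (τ.noiseVec T ω)) inferInstance) S T t τ h.follows ht
    ((comap_measurable _).mono le_sup_right le_rfl) fun s hs hy =>
      (h.causal s (by omega)).mono (sup_le le_sup_left (iSup_le fun r =>
        (hy r (Nat.lt_succ_iff.1 r.2)).comap_le)) le_rfl

/-- Whatever the causal input, the error of the estimator is independent of the past: the inputs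
add to the outputs of the free system only what is known, and exogenous information. -/
theorem Trajectory.IsCausalRun.indepFun_error_past (h : τ.IsCausalRun 𝓖 S T μ) (ht : t ≤ T)
    {K : EuclideanSpace ℝ (Fin (t + 1) × Fin p) →L[ℝ] EuclideanSpace ℝ (Fin n)}
    (hK : IndepFun (estimatorError S T t K) (freeOutputs S T t) (noiseLaw S T)) :
    IndepFun (fun ω => estimatorError S T t K (τ.noiseVec T ω)) (τ.past t) μ := by
  have hnm := h.gaussian.measurable_noiseVec
  set f := fun ω => estimatorError S T t K (τ.noiseVec T ω) with hf
  set g := fun ω => freeOutputs S T t (τ.noiseVec T ω) with hg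
  have hfm : Measurable f := (estimatorError S T t K).measurable.comp hnm
  have hgm : Measurable g := (freeOutputs S T t).measurable.comp hnm
  have hfg : IndepFun f g μ := by
    rw [← h.gaussian.map_noiseVec h.indep] at hK
    rw [indepFun_iff_map_prod_eq_prod_map_map (ContinuousLinearMap.measurable _).aemeasurable
      (ContinuousLinearMap.measurable _).aemeasurable,
      Measure.map_map (ContinuousLinearMap.measurable _) hnm,
      Measure.map_map (ContinuousLinearMap.measurable _) hnm,
      Measure.map_map ((ContinuousLinearMap.measurable _).prodMk
        (ContinuousLinearMap.measurable _)) hnm] at hK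
    exact (indepFun_iff_map_prod_eq_prod_map_map hfm.aemeasurable hgm.aemeasurable).2 hK
  have hnoise : MeasurableSpace.comap (τ.noiseVec T) inferInstance
      ≤ ⨆ k : NoiseSource T, MeasurableSpace.comap (τ.noise k) inferInstance := by
    refine Measurable.comap_le (@measurable_pi_lambda _ _ _ (_) _ _ fun k => ?_)
    exact (comap_measurable (τ.noise k)).mono
      (le_iSup (fun k : NoiseSource T => MeasurableSpace.comap (τ.noise k) inferInstance) k) le_rfl
  have hle : MeasurableSpace.comap f inferInstance ⊔ MeasurableSpace.comap g inferInstance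
      ≤ ⨆ k : NoiseSource T, MeasurableSpace.comap (τ.noise k) inferInstance := by
    refine (sup_le ?_ ?_).trans hnoise
    · exact Measurable.comap_le ((ContinuousLinearMap.measurable _).comp (comap_measurable _))
    · exact Measurable.comap_le ((ContinuousLinearMap.measurable _).comp (comap_measurable _))
  have hind := indep_sup_right_of_indep hfm.comap_le hgm.comap_le h.exogenous_le hfg
    (indep_of_indep_of_le_right h.exogenous_indep hle)
  exact indep_of_indep_of_le_right hind (h.measurable_past ht).comap_le

theorem Trajectory.IsCausalRun.measurable_past' (h : τ.IsCausalRun 𝓖 S T μ) (ht : t ≤ T) :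
    Measurable (τ.past t) :=
  (h.measurable_past ht).mono (sup_le h.exogenous_le
    ((freeOutputs S T t).measurable.comp h.gaussian.measurable_noiseVec).comap_le) le_rfl

end NoiseLaw

/-! ### Covariance matrices -/

section Covariance

variable {Ω : Type*} [MeasurableSpace Ω] {μ : Measure Ω}

theorem variance_inner_eq [IsProbabilityMeasure μ] {ι : Type*} [Fintype ι]
    {X : Ω → EuclideanSpace ℝ ι} (hX : MemLp X 2 μ) (b : EuclideanSpace ℝ ι) :
    variance (fun ω => inner ℝ b (X ω)) μ = b.ofLp ⬝ᵥ (covMat X μ).mulVec b.ofLp := by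
  have hXi : ∀ i, MemLp (fun ω => X ω i) 2 μ := fun i => hX.eval_piLp i
  have h1 : (fun ω => (inner ℝ b (X ω) : ℝ)) = fun ω => ∑ i, b i * X ω i := by
    ext ω; simp [PiLp.inner_apply, mul_comm]
  have hm : AEMeasurable (fun ω => ∑ i, b i * X ω i) μ :=
    (memLp_finsetSum Finset.univ fun i _ => (hXi i).const_mul (b i)).1.aemeasurable
  rw [h1, ← covariance_self hm, covariance_fun_sum_fun_sum (fun i => (hXi i).const_mul _)
    (fun i => (hXi i).const_mul _)]
  simp only [covariance_const_mul_left, covariance_const_mul_right, dotProduct, Matrix.mulVec,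
    covMat, Matrix.of_apply, Finset.mul_sum]
  refine Finset.sum_congr rfl fun i _ => Finset.sum_congr rfl fun j _ => ?_
  ring

theorem variance_inner_multivariateGaussian {ι : Type*} [Fintype ι] [DecidableEq ι]
    {C : Matrix ι ι ℝ} (hC : C.PosSemidef) (b : EuclideanSpace ℝ ι) :
    variance (fun x => inner ℝ b x) (multivariateGaussian 0 C) = b.ofLp ⬝ᵥ C.mulVec b.ofLp := by
  rw [← covarianceBilin_multivariateGaussian (μ := 0) hC b b,
    covarianceBilin_self IsGaussian.memLp_two_id]

theorem covMat_congr {ι : Type*} {X Y : Ω → EuclideanSpace ℝ ι} (h : X =ᵐ[μ] Y) :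
    covMat X μ = covMat Y μ := by
  ext i j
  simp only [covMat, Matrix.of_apply]
  have hi : ∀ i, ∫ ω, X ω i ∂μ = ∫ ω, Y ω i ∂μ := fun i =>
    integral_congr_ae (h.mono fun ω hω => by simp only [hω])
  simp only [covariance, hi]
  exact integral_congr_ae (h.mono fun ω hω => by simp only [hω])

theorem covMat_posDef [IsProbabilityMeasure μ] {ι : Type*} [Fintype ι]
    {X : Ω → EuclideanSpace ℝ ι} (hX : MemLp X 2 μ)
    (h : ∀ b : EuclideanSpace ℝ ι, variance (fun ω => inner ℝ b (X ω)) μ = 0 → b = 0) :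
    (covMat X μ).PosDef := by
  refine Matrix.PosDef.of_dotProduct_mulVec_pos ?_ fun b hb => ?_
  · ext i j
    simp [covMat, covariance_comm]
  · have hv := variance_inner_eq hX (WithLp.toLp 2 b)
    have h0 : variance (fun ω => inner ℝ (WithLp.toLp 2 b) (X ω)) μ ≠ 0 := fun h0 =>
      hb (by simpa using h _ h0)
    rw [star_trivial]
    change 0 < (WithLp.toLp 2 b).ofLp ⬝ᵥ _
    rw [← hv]
    exact lt_of_le_of_ne (variance_nonneg _ _) h0.symm

theorem hasSubgaussianMGF_of_hasGaussianLaw {X : Ω → ℝ} (hX : HasGaussianLaw X μ)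
    (h0 : ∫ ω, X ω ∂μ = 0) {c : NNReal} (hc : variance X μ ≤ c) : HasSubgaussianMGF X c μ := by
  have hlaw := hX.map_eq_gaussianReal
  rw [h0] at hlaw
  refine ⟨fun t => ?_, fun t => ?_⟩
  · have h := integrable_exp_mul_gaussianReal (μ := 0) (v := (variance X μ).toNNReal) t
    rw [← hlaw, integrable_map_measure (by fun_prop) hX.aemeasurable] at h
    exact h
  · rw [mgf_gaussianReal hlaw, zero_mul, zero_add, Real.coe_toNNReal _ (variance_nonneg _ _)]
    gcongr

end Covariance

/-! ### Data from independent experiments with Gaussian inputs -/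

section Dataset

variable {n m p : ℕ}

/-- The values of the noise sources and the inputs of an experiment with horizon `T`. -/
abbrev SourceVec (n m p T : ℕ) : Type :=
  (k : NoiseSource T ⊕ Fin T) → EuclideanSpace ℝ (Fin (sourceDim n m p k))

/-- The covariances of the noise sources and the inputs of an experiment. -/
def sourceCov (S : LinearSystem n m p) (Su : Matrix (Fin m) (Fin m) ℝ) {T : ℕ} :
    (k : NoiseSource T ⊕ Fin T) →
      Matrix (Fin (sourceDim n m p k)) (Fin (sourceDim n m p k)) ℝ
  | .inl k => S.noiseCov k
  | .inr _ => Su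

/-- The noise of an experiment as a function of all its sources. -/
noncomputable def noisePart (n m p T : ℕ) : SourceVec n m p T →L[ℝ] NoiseVec n p T :=
  ContinuousLinearMap.pi fun k => ContinuousLinearMap.proj (R := ℝ)
    (φ := fun k : NoiseSource T ⊕ Fin T => EuclideanSpace ℝ (Fin (sourceDim n m p k))) (.inl k)

/-- The input `u(s)` as a function of the sources. -/
noncomputable def inputProj (n m p : ℕ) {T : ℕ} (s : Fin T) :
    SourceVec n m p T →L[ℝ] EuclideanSpace ℝ (Fin m) :=
  ContinuousLinearMap.proj (R := ℝ)
    (φ := fun k : NoiseSource T ⊕ Fin T => EuclideanSpace ℝ (Fin (sourceDim n m p k))) (.inr s)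

/-- The state at time `s` as a function of the sources. -/
noncomputable def sourceState (S : LinearSystem n m p) (T : ℕ) :
    ℕ → SourceVec n m p T →L[ℝ] EuclideanSpace ℝ (Fin n) :=
  stateMap S (initProj n p T ∘L noisePart n m p T)
    (fun s => if h : s < T then inputProj n m p ⟨s, h⟩ else 0)
    fun s => if h : s < T then processProj n p ⟨s, h⟩ ∘L noisePart n m p T else 0

/-- The vector `[u(0); …; u(t-1); y(0); …; y(t)]` as a function of the sources. -/
noncomputable def pastMap (S : LinearSystem n m p) (T t : ℕ) :
    SourceVec n m p T →L[ℝ] EuclideanSpace ℝ (PastIndex m p t) :=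
  euclideanPi (Sum.elim
    (fun q => EuclideanSpace.proj q.2 ∘L
      if h : (q.1 : ℕ) < T then inputProj n m p ⟨q.1, h⟩ else 0)
    (fun q => EuclideanSpace.proj q.2 ∘L (matrixCLM S.C ∘L sourceState S T q.1
      + if h : (q.1 : ℕ) < T + 1 then measurementProj n p ⟨q.1, h⟩ ∘L noisePart n m p T else 0)))

/-- The sources of a run. -/
def Trajectory.sourceVec {Ω : Type*} (τ : Trajectory n m p Ω) (T : ℕ) (ω : Ω) :
    SourceVec n m p T :=
  fun k => τ.source k ω

variable {Ω : Type*} {S : LinearSystem n m p} {T t : ℕ}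

theorem Trajectory.Follows.sourceState_eq {τ : Trajectory n m p Ω} (h : τ.Follows S T) (ω : Ω)
    {s : ℕ} (hs : s ≤ T) : τ.x s ω = sourceState S T s (τ.sourceVec T ω) := by
  induction s with
  | zero => rfl
  | succ s ih =>
    have hsT : s < T := by omega
    have hu : inputProj n m p ⟨s, hsT⟩ (τ.sourceVec T ω) = τ.u s ω := rfl
    have hw : processProj n p ⟨s, hsT⟩ (noisePart n m p T (τ.sourceVec T ω)) = τ.w s ω := rfl
    rw [h.1 s hsT ω, ih (by omega)]
    simp only [sourceState, stateMap, add_apply, ContinuousLinearMap.comp_apply, dif_pos hsT, hu,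
      hw, LinearMap.coe_toContinuousLinearMap']

theorem Trajectory.Follows.past_eq {τ : Trajectory n m p Ω} (h : τ.Follows S T) (ht : t ≤ T)
    (ω : Ω) : τ.past t ω = pastMap S T t (τ.sourceVec T ω) := by
  ext q
  rcases q with ⟨s, j⟩ | ⟨s, j⟩
  · have hs : (s : ℕ) < T := by omega
    simp only [pastMap, euclideanPi_apply, Sum.elim_inl, dif_pos hs]
    rfl
  · have hs : (s : ℕ) < T + 1 := by omega
    have hv : measurementProj n p ⟨s, hs⟩ (noisePart n m p T (τ.sourceVec T ω)) = τ.v s ω := rfl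
    simp only [pastMap, euclideanPi_apply, Sum.elim_inr, dif_pos hs, add_apply,
      ContinuousLinearMap.comp_apply, hv, ← h.sourceState_eq ω (Nat.lt_succ_iff.1 hs)]
    change τ.y s ω j = _
    rw [h.2 s (by omega) ω]
    rfl

section NonDegenerate

noncomputable instance (T : ℕ) : DecidableEq (NoiseSource T) := Classical.decEq _

/-- The values of the sources if all of them are zero except one. -/
noncomputable def singleSource (n m p : ℕ) {T : ℕ} (k : NoiseSource T ⊕ Fin T)
    (v : EuclideanSpace ℝ (Fin (sourceDim n m p k))) : SourceVec n m p T :=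
  Pi.single k v

theorem singleSource_of_ne (k l : NoiseSource T ⊕ Fin T)
    (v : EuclideanSpace ℝ (Fin (sourceDim n m p k))) (h : l ≠ k) : singleSource n m p k v l = 0 :=
  Pi.single_eq_of_ne (M := fun k => EuclideanSpace ℝ (Fin (sourceDim n m p k))) h v

theorem singleSource_same (k : NoiseSource T ⊕ Fin T)
    (v : EuclideanSpace ℝ (Fin (sourceDim n m p k))) : singleSource n m p k v k = v :=
  Pi.single_eq_same (M := fun k => EuclideanSpace ℝ (Fin (sourceDim n m p k))) k v

theorem sourceState_single_measurement (r : Fin (T + 1)) (v : EuclideanSpace ℝ (Fin p)) (s : ℕ) :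
    sourceState S T s (singleSource n m p (.inl (.measurement r)) v) = 0 := by
  induction s with
  | zero =>
    simp only [sourceState, stateMap, ContinuousLinearMap.comp_apply]
    exact singleSource_of_ne (.inl (.measurement r)) (.inl .init) v (by simp)
  | succ s ih =>
    simp only [sourceState, stateMap, add_apply, ContinuousLinearMap.comp_apply] at ih ⊢
    rw [ih]
    split_ifs with h
    · have hu : inputProj n m p ⟨s, h⟩ (singleSource n m p (.inl (.measurement r)) v) = 0 :=
        singleSource_of_ne (.inl (.measurement r)) (.inr ⟨s, h⟩) v (by simp)
      have hw : processProj n p ⟨s, h⟩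
          (noisePart n m p T (singleSource n m p (.inl (.measurement r)) v)) = 0 :=
        singleSource_of_ne (.inl (.measurement r)) (.inl (.process ⟨s, h⟩)) v (by simp)
      simp [hu, hw]
    · simp

theorem inner_pastMap_single_measurement (ht : t ≤ T) (b : EuclideanSpace ℝ (PastIndex m p t))
    (r : Fin (t + 1)) (v : EuclideanSpace ℝ (Fin p)) :
    inner ℝ b (pastMap S T t (singleSource n m p (.inl (.measurement (r.castLE (by omega)))) v))
      = inner ℝ (WithLp.toLp 2 fun j => b (.inr (r, j))) v := by
  set ξ := singleSource n m p (.inl (.measurement (r.castLE (by omega : t + 1 ≤ T + 1)))) v with hξ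
  have h1 : ∀ q, pastMap S T t ξ (.inl q) = 0 := by
    intro q
    have hq : (q.1 : ℕ) < T := by omega
    have hu : inputProj n m p ⟨q.1, hq⟩ ξ = 0 :=
      singleSource_of_ne (.inl (.measurement (r.castLE (by omega)))) (.inr ⟨q.1, hq⟩) v (by simp)
    simp only [pastMap, euclideanPi_apply, Sum.elim_inl, dif_pos hq,
      ContinuousLinearMap.comp_apply, hu, map_zero]
  have h2 : ∀ q, pastMap S T t ξ (.inr q) = if q.1 = r then v q.2 else 0 := by
    intro q
    have hq : (q.1 : ℕ) < T + 1 := by omega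
    have hv : measurementProj n p ⟨q.1, hq⟩ (noisePart n m p T ξ) = if q.1 = r then v else 0 := by
      split_ifs with h
      · subst h
        exact singleSource_same (.inl (.measurement _)) v
      · refine singleSource_of_ne (.inl (.measurement _)) (.inl (.measurement ⟨q.1, hq⟩)) v ?_
        simpa [Fin.ext_iff] using h
    have hx : sourceState S T q.1 ξ = 0 := sourceState_single_measurement _ v _
    simp only [pastMap, euclideanPi_apply, Sum.elim_inr, dif_pos hq,
      ContinuousLinearMap.comp_apply, add_apply, hv, hx, map_zero, zero_add]
    split_ifs
    · rfl
    · simp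
  simp only [PiLp.inner_apply, Fintype.sum_sum_type, h1, h2, Fintype.sum_prod_type]
  simp

theorem inner_pastMap_single_input (ht : t ≤ T) (b : EuclideanSpace ℝ (PastIndex m p t))
    (hb : ∀ q, b (.inr q) = 0) (r : Fin t) (v : EuclideanSpace ℝ (Fin m)) :
    inner ℝ b (pastMap S T t (singleSource n m p (.inr (r.castLE ht)) v))
      = inner ℝ (WithLp.toLp 2 fun j => b (.inl (r, j))) v := by
  set ξ := singleSource n m p (.inr (r.castLE ht)) v with hξ
  have h1 : ∀ q, pastMap S T t ξ (.inl q) = if q.1 = r then v q.2 else 0 := by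
    intro q
    have hq : (q.1 : ℕ) < T := by omega
    have hu : inputProj n m p ⟨q.1, hq⟩ ξ = if q.1 = r then v else 0 := by
      split_ifs with h
      · subst h
        exact singleSource_same (.inr _) v
      · refine singleSource_of_ne (.inr _) (.inr ⟨q.1, hq⟩) v ?_
        simpa [Fin.ext_iff] using h
    simp only [pastMap, euclideanPi_apply, Sum.elim_inl, dif_pos hq,
      ContinuousLinearMap.comp_apply, hu]
    split_ifs
    · rfl
    · simp
  simp only [PiLp.inner_apply, Fintype.sum_sum_type, h1, hb, Fintype.sum_prod_type]
  simp

end NonDegenerate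

variable [MeasurableSpace Ω] {μ : Measure Ω} [IsProbabilityMeasure μ]
  {D : ℕ → Trajectory n m p Ω} {Su : Matrix (Fin m) (Fin m) ℝ}

theorem IsDataset.measurable_source (h : IsDataset D S Su T μ) (i : ℕ)
    (k : NoiseSource T ⊕ Fin T) : Measurable ((D i).source k) := by
  cases k with
  | inl k => exact (h.gaussian i k).1
  | inr s => exact (h.input_gaussian i s s.2).1

theorem IsDataset.measurable_sourceVec (h : IsDataset D S Su T μ) (i : ℕ) :
    Measurable ((D i).sourceVec T) := measurable_pi_lambda _ (h.measurable_source i)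

theorem IsDataset.iIndepFun_source (h : IsDataset D S Su T μ) (i : ℕ) :
    iIndepFun (fun k : NoiseSource T ⊕ Fin T => (D i).source k) μ :=
  h.indep.precomp (g := fun k => (i, k)) (Prod.mk_right_injective i)

theorem IsDataset.map_sourceVec (h : IsDataset D S Su T μ) (i : ℕ) :
    μ.map ((D i).sourceVec T) = gaussianPi (sourceCov S Su) := by
  refine map_eq_gaussianPi _ (h.iIndepFun_source i) (h.measurable_source i) fun k => ?_
  cases k with
  | inl k => exact (h.gaussian i k).2
  | inr s => exact (h.input_gaussian i s s.2).2

/-- Every experiment is a run whose inputs are exogenous. -/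
theorem IsDataset.isCausalRun (h : IsDataset D S Su T μ) (i : ℕ) :
    (D i).IsCausalRun (⨆ s : Fin T, MeasurableSpace.comap ((D i).u s) inferInstance) S T μ where
  follows := h.follows i
  gaussian := h.gaussian i
  indep := (h.iIndepFun_source i).precomp
    (g := (Sum.inl : NoiseSource T → NoiseSource T ⊕ Fin T)) Sum.inl_injective
  exogenous_le := iSup_le fun s => (h.input_gaussian i s s.2).1.comap_le
  exogenous_indep := by
    have h1 := indep_iSup_of_disjoint (fun k => (h.measurable_source i k).comap_le)
      (h.iIndepFun_source i) (S := Set.range Sum.inr) (T := Set.range Sum.inl)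
      (Set.isCompl_range_inl_range_inr.disjoint.symm)
    refine indep_of_indep_of_le_left (indep_of_indep_of_le_right h1 ?_) ?_
    · exact iSup_le fun k => le_iSup₂_of_le (Sum.inl k) ⟨k, rfl⟩ le_rfl
    · exact iSup_le fun k => le_iSup₂_of_le (Sum.inr k) ⟨k, rfl⟩ le_rfl
  causal s hs := (comap_measurable ((D i).u s)).mono
    ((le_iSup (fun s : Fin T => MeasurableSpace.comap ((D i).u s) inferInstance) ⟨s, hs⟩).trans
      le_sup_left) le_rfl

theorem IsDataset.iIndepFun_sourceVec (h : IsDataset D S Su T μ) :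
    iIndepFun (fun i => (D i).sourceVec T) μ :=
  iIndepFun_curry (X := fun i k => (D i).source k) h.measurable_source h.indep

theorem IsDataset.hasGaussianLaw_sourceVec (h : IsDataset D S Su T μ) (i : ℕ) :
    HasGaussianLaw ((D i).sourceVec T) μ := by
  have := (hasGaussianLaw_id_gaussianPi (sourceCov S Su (T := T))).isGaussian_map
  rw [Measure.map_id'] at this
  exact ⟨by rwa [h.map_sourceVec i]⟩

theorem IsDataset.integral_comp_sourceVec (h : IsDataset D S Su T μ) (i : ℕ)
    (ℓ : SourceVec n m p T →L[ℝ] ℝ) : ∫ ω, ℓ ((D i).sourceVec T ω) ∂μ = 0 := by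
  rw [← integral_map (h.measurable_sourceVec i).aemeasurable (f := fun ξ => ℓ ξ)
    ℓ.continuous.aestronglyMeasurable, h.map_sourceVec i, integral_gaussianPi]

theorem IsDataset.variance_comp_sourceVec (h : IsDataset D S Su T μ) (i : ℕ)
    (ℓ : SourceVec n m p T →L[ℝ] ℝ) :
    variance (fun ω => ℓ ((D i).sourceVec T ω)) μ = variance ℓ (gaussianPi (sourceCov S Su)) := by
  rw [← h.map_sourceVec i, variance_map ℓ.continuous.aemeasurable
    (h.measurable_sourceVec i).aemeasurable]
  rfl

theorem variance_gaussianPi {K : Type*} [Fintype K] [DecidableEq K] {dim : K → ℕ}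
    (C : (k : K) → Matrix (Fin (dim k)) (Fin (dim k)) ℝ)
    (ℓ : ((k : K) → EuclideanSpace ℝ (Fin (dim k))) →L[ℝ] ℝ) :
    variance ℓ (gaussianPi C)
      = ∑ k, variance (fun v => ℓ (Pi.single k v)) (multivariateGaussian 0 (C k)) := by
  let f : (k : K) → EuclideanSpace ℝ (Fin (dim k)) →L[ℝ] ℝ := fun k =>
    ℓ ∘L ContinuousLinearMap.single ℝ (fun k => EuclideanSpace ℝ (Fin (dim k))) k
  have hev : ∀ k, (gaussianPi C).map (fun ξ => ξ k) = multivariateGaussian 0 (C k) := fun k =>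
    (measurePreserving_eval _ k).map_eq
  have hsum : (ℓ : ((k : K) → EuclideanSpace ℝ (Fin (dim k))) → ℝ)
      = ∑ k, fun ξ : (k : K) → EuclideanSpace ℝ (Fin (dim k)) => f k (ξ k) := by
    ext ξ
    rw [Finset.sum_apply]
    conv_lhs => rw [← Finset.univ_sum_single ξ, map_sum]
    rfl
  have hind : iIndepFun (fun k (ξ : (k : K) → EuclideanSpace ℝ (Fin (dim k))) => f k (ξ k))
      (gaussianPi C) :=
    iIndepFun_pi (X := fun k x => f k x) fun k => (f k).continuous.aemeasurable
  have hm : ∀ k, MemLp (fun ξ : (k : K) → EuclideanSpace ℝ (Fin (dim k)) => f k (ξ k)) 2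
      (gaussianPi C) := fun k =>
    ((hasGaussianLaw_id_gaussianPi C).map_fun (f k ∘L ContinuousLinearMap.proj k)).memLp_two
  have hk : ∀ k, variance (fun ξ => f k (ξ k)) (gaussianPi C)
      = variance (f k) (multivariateGaussian 0 (C k)) := fun k => by
    rw [← hev k, variance_map (f k).continuous.aemeasurable (measurable_pi_apply k).aemeasurable]
    rfl
  rw [show variance ℓ (gaussianPi C) = _ from congrArg (fun X => variance X (gaussianPi C)) hsum,
    IndepFun.variance_sum (fun k _ => hm k) fun i _ j _ hij => hind.indepFun hij]
  exact Finset.sum_congr rfl fun k _ => hk k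

theorem IsDataset.memLp_past (h : IsDataset D S Su T μ) (ht : t ≤ T) (i : ℕ) :
    MemLp (fun ω => (D i).past t ω) 2 μ := by
  simp only [(h.follows i).past_eq ht]
  exact ((h.hasGaussianLaw_sourceVec i).map_fun (pastMap S T t)).memLp_two

theorem IsDataset.variance_inner_past (h : IsDataset D S Su T μ) (ht : t ≤ T) (i : ℕ)
    (b : EuclideanSpace ℝ (PastIndex m p t)) :
    variance (fun ω => inner ℝ b ((D i).past t ω)) μ
      = variance (fun ξ => inner ℝ b (pastMap S T t ξ)) (gaussianPi (sourceCov S Su)) := by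
  simp only [(h.follows i).past_eq ht]
  exact h.variance_comp_sourceVec i (innerSL ℝ b ∘L pastMap S T t)

/-- The covariance of the past is positive definite: the measurement noises make the outputs
non-degenerate, and the inputs are non-degenerate. -/
theorem IsDataset.posDef_covMat_past (h : IsDataset D S Su T μ) (hSu : Su.PosDef) (ht : t ≤ T)
    (i : ℕ) : (covMat (fun ω => (D i).past t ω) μ).PosDef := by
  refine covMat_posDef (h.memLp_past ht i) fun b hb => ?_
  rw [h.variance_inner_past ht i b] at hb
  have hsum := variance_gaussianPi (sourceCov S Su) (innerSL ℝ b ∘L pastMap S T t)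
  have hzero := (Finset.sum_eq_zero_iff_of_nonneg fun k _ => variance_nonneg _ _).1
    (hsum.symm.trans hb)
  have hy : ∀ r : Fin (t + 1), (WithLp.toLp 2 fun j => b (.inr (r, j)) :
      EuclideanSpace ℝ (Fin p)) = 0 := by
    intro r
    have h1 := hzero (.inl (.measurement (r.castLE (by omega)))) (Finset.mem_univ _)
    have h2 := variance_inner_multivariateGaussian S.Rv_posDef.posSemidef
      (WithLp.toLp 2 fun j => b (.inr (r, j)))
    simp only [← inner_pastMap_single_measurement (S := S) ht b r] at h2
    by_contra hne
    have h3 := S.Rv_posDef.dotProduct_mulVec_pos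
      (x := fun j => b (.inr (r, j))) (fun h0 => hne (by rw [h0]; rfl))
    rw [star_trivial] at h3
    exact h3.ne' (h2.symm.trans h1)
  have hy' : ∀ q, b (.inr q) = 0 := fun q => congrArg (fun v => v.ofLp q.2) (hy q.1)
  have hu : ∀ r : Fin t, (WithLp.toLp 2 fun j => b (.inl (r, j)) :
      EuclideanSpace ℝ (Fin m)) = 0 := by
    intro r
    have h1 := hzero (.inr (r.castLE ht)) (Finset.mem_univ _)
    have h2 := variance_inner_multivariateGaussian hSu.posSemidef
      (WithLp.toLp 2 fun j => b (.inl (r, j)))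
    simp only [← inner_pastMap_single_input (S := S) ht b hy' r] at h2
    by_contra hne
    have h3 := hSu.dotProduct_mulVec_pos
      (x := fun j => b (.inl (r, j))) (fun h0 => hne (by rw [h0]; rfl))
    rw [star_trivial] at h3
    exact h3.ne' (h2.symm.trans h1)
  ext q
  rcases q with q | q
  · exact congrArg (fun v => v.ofLp q.2) (hu q.1)
  · exact hy' q

/-- The regressors and the errors of all experiments are jointly Gaussian, hence independent as
they are uncorrelated: within one experiment because the error is independent of the past, and
across experiments because these are independent. -/
theorem IsDataset.indepFun_past_error (h : IsDataset D S Su T μ) (ht : t ≤ T) (N : ℕ)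
    {K : EuclideanSpace ℝ (Fin (t + 1) × Fin p) →L[ℝ] EuclideanSpace ℝ (Fin n)}
    (hK : IndepFun (estimatorError S T t K) (freeOutputs S T t) (noiseLaw S T)) :
    IndepFun (fun ω (i : Fin N) => (D i).past t ω)
      (fun ω (i : Fin N) => estimatorError S T t K ((D i).noiseVec T ω)) μ := by
  set e := estimatorError S T t K ∘L noisePart n m p T with he
  let P := pastMap S T t
  have hind : iIndepFun (fun (i : Fin N) => (D i).sourceVec T) μ :=
    h.iIndepFun_sourceVec.precomp Fin.val_injective
  have hG : HasGaussianLaw (fun ω (i : Fin N) => (D i).sourceVec T ω) μ :=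
    iIndepFun.hasGaussianLaw (fun i : Fin N => h.hasGaussianLaw_sourceVec i) hind
  let LP : (Fin N → SourceVec n m p T) →L[ℝ] (Fin N × PastIndex m p t → ℝ) :=
    ContinuousLinearMap.pi fun q => EuclideanSpace.proj q.2 ∘L P ∘L ContinuousLinearMap.proj q.1
  let LE : (Fin N → SourceVec n m p T) →L[ℝ] (Fin N × Fin n → ℝ) :=
    ContinuousLinearMap.pi fun q => EuclideanSpace.proj q.2 ∘L e ∘L ContinuousLinearMap.proj q.1
  have hjoint := hG.map_fun (LP.prod LE)
  have hmem : ∀ (i : ℕ) (ℓ : SourceVec n m p T →L[ℝ] ℝ),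
      MemLp (fun ω => ℓ ((D i).sourceVec T ω)) 2 μ := fun i ℓ =>
    ((h.hasGaussianLaw_sourceVec i).map_fun ℓ).memLp_two
  have hcoord := hjoint.indepFun_of_covariance_eval
    (X := fun (q : Fin N × PastIndex m p t) ω => P ((D q.1).sourceVec T ω) q.2)
    (Y := fun (q : Fin N × Fin n) ω => e ((D q.1).sourceVec T ω) q.2)
    (by
      rintro ⟨i, k⟩ ⟨j, l⟩
      refine IndepFun.covariance_eq_zero ?_ (hmem i (EuclideanSpace.proj k ∘L P))
        (hmem j (EuclideanSpace.proj l ∘L e))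
      have hk : Measurable fun c : EuclideanSpace ℝ (PastIndex m p t) => c k := by fun_prop
      have hl : Measurable fun c : EuclideanSpace ℝ (Fin n) => c l := by fun_prop
      rcases eq_or_ne i j with rfl | hij
      · have h1 := ((h.isCausalRun i).indepFun_error_past ht hK).symm.comp hk hl
        have h2 : (D i).past t = fun ω => P ((D i).sourceVec T ω) :=
          funext fun ω => (h.follows i).past_eq ht ω
        rw [h2] at h1
        exact h1
      · exact (hind.indepFun hij).comp (hk.comp P.measurable) (hl.comp e.measurable))
  have h3 := hcoord.comp (φ := fun c i => (WithLp.toLp 2 fun k => c (i, k) :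
      EuclideanSpace ℝ (PastIndex m p t)))
    (ψ := fun c i => (WithLp.toLp 2 fun k => c (i, k) : EuclideanSpace ℝ (Fin n)))
    (by fun_prop) (by fun_prop)
  simp only [(h.follows _).past_eq ht]
  exact h3

end Dataset

/-! ### The Kalman estimate and the data-driven gain -/

section Whitening

open scoped Matrix MatrixOrder Matrix.Norms.L2Operator

variable {ι : Type*} [Fintype ι] [DecidableEq ι]

theorem inv_sqrt_transpose (C : Matrix ι ι ℝ) : ((CFC.sqrt C)⁻¹)ᵀ = (CFC.sqrt C)⁻¹ := by
  have h : (CFC.sqrt C).IsHermitian :=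
    (Matrix.nonneg_iff_posSemidef.1 (CFC.sqrt_nonneg C)).isHermitian
  rw [Matrix.IsHermitian, Matrix.conjTranspose_eq_transpose_of_trivial] at h
  rw [Matrix.transpose_nonsing_inv, h]

theorem isUnit_det_sqrt {C : Matrix ι ι ℝ} (hC : C.PosDef) : IsUnit (CFC.sqrt C).det := by
  have h := congrArg Matrix.det
    (CFC.sqrt_mul_sqrt_self C (Matrix.nonneg_iff_posSemidef.2 hC.posSemidef))
  rw [Matrix.det_mul] at h
  exact isUnit_iff_ne_zero.2 fun h0 => hC.det_pos.ne' (by rw [← h, h0, zero_mul])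

theorem dotProduct_mulVec_inv_sqrt {C : Matrix ι ι ℝ} (hC : C.PosDef) (v : EuclideanSpace ℝ ι) :
    ((CFC.sqrt C)⁻¹.toEuclideanLin v).ofLp ⬝ᵥ C.mulVec ((CFC.sqrt C)⁻¹.toEuclideanLin v).ofLp
      = ‖v‖ ^ 2 := by
  have hu := isUnit_det_sqrt hC
  have hs := CFC.sqrt_mul_sqrt_self C (Matrix.nonneg_iff_posSemidef.2 hC.posSemidef)
  have h1 : C.mulVec ((CFC.sqrt C)⁻¹.mulVec v.ofLp) = (CFC.sqrt C).mulVec v.ofLp := by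
    nth_rw 1 [← hs]
    rw [Matrix.mulVec_mulVec, Matrix.mul_assoc, Matrix.mul_nonsing_inv _ hu, Matrix.mul_one]
  have h2 : ((CFC.sqrt C)⁻¹.toEuclideanLin v).ofLp = (CFC.sqrt C)⁻¹.mulVec v.ofLp := rfl
  rw [h2, h1, dotProduct_comm, Matrix.dotProduct_mulVec, ← Matrix.mulVec_transpose,
    inv_sqrt_transpose, Matrix.mulVec_mulVec, Matrix.nonsing_inv_mul _ hu, Matrix.one_mulVec,
    EuclideanSpace.real_norm_sq_eq]
  simp [dotProduct, sq]

theorem dotProduct_mulVec_le_norm (C : Matrix ι ι ℝ) {a : EuclideanSpace ℝ ι} (ha : ‖a‖ = 1) :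
    a.ofLp ⬝ᵥ C.mulVec a.ofLp ≤ ‖C‖ := by
  have h1 : a.ofLp ⬝ᵥ C.mulVec a.ofLp = inner ℝ a (C.toEuclideanLin a) := by
    simp [PiLp.inner_apply, dotProduct, Matrix.toLpLin_apply, mul_comm]
  rw [h1]
  calc inner ℝ a (C.toEuclideanLin a) ≤ ‖a‖ * ‖C.toEuclideanLin a‖ := real_inner_le_norm _ _
    _ ≤ ‖a‖ * (‖C‖ * ‖a‖) := by
      gcongr
      exact Matrix.l2_opNorm_mulVec C a
    _ = ‖C‖ := by rw [ha]; ring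

end Whitening

section Estimate

variable {n m p : ℕ} {Ω : Type*} {S : LinearSystem n m p} {T t : ℕ}

section KalmanEstimate

variable {𝓖 : MeasurableSpace Ω} [mΩ : MeasurableSpace Ω] {μ : Measure Ω}
  [IsProbabilityMeasure μ] {τ : Trajectory n m p Ω}

theorem memLp_estimatorError
    (K : EuclideanSpace ℝ (Fin (t + 1) × Fin p) →L[ℝ] EuclideanSpace ℝ (Fin n)) :
    MemLp (estimatorError S T t K) 2 (noiseLaw S T) :=
  ((hasGaussianLaw_id_gaussianPi _).map_fun (estimatorError S T t K)).memLp_two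

/-- The Kalman estimate is the linear estimate with the regression gain. -/
theorem IsKalmanEstimate.ae_eq {xhat : Ω → EuclideanSpace ℝ (Fin n)}
    (hx : IsKalmanEstimate τ t μ xhat) (h : τ.IsCausalRun 𝓖 S T μ) (ht : t ≤ T)
    {K : EuclideanSpace ℝ (Fin (t + 1) × Fin p) →L[ℝ] EuclideanSpace ℝ (Fin n)}
    (hK : IndepFun (estimatorError S T t K) (freeOutputs S T t) (noiseLaw S T)) :
    ∀ᵐ ω ∂μ, xhat ω = estimatorGain S t K (τ.past t ω) := by
  obtain ⟨⟨g, hg, hxg⟩, hmin⟩ := hx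
  have hn := h.gaussian.measurable_noiseVec
  have hlaw := h.gaussian.map_noiseVec h.indep
  have he2 : MemLp (fun ω => estimatorError S T t K (τ.noiseVec T ω)) 2 μ := by
    have := memLp_estimatorError (S := S) (T := T) K
    rw [← hlaw] at this
    exact this.comp_of_map hn.aemeasurable
  have he0 : ∀ i, ∫ ω, estimatorError S T t K (τ.noiseVec T ω) i ∂μ = 0 := fun i => by
    have := integral_gaussianPi (dim := fun k : NoiseSource T => k.dim n p) S.noiseCov
      (EuclideanSpace.proj i ∘L estimatorError S T t K)
    change ∫ ξ, _ ∂(noiseLaw S T) = 0 at this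
    rw [← hlaw, integral_map hn.aemeasurable
      (ContinuousLinearMap.continuous _).aestronglyMeasurable] at this
    exact this
  have hae := ae_eq_of_minimizes (h.measurable_past' ht)
    ((estimatorError S T t K).measurable.comp hn) he2 he0 (h.indepFun_error_past ht hK)
    (φ := estimatorGain S t K) (g := g) (ContinuousLinearMap.measurable _) hg
    (h.follows.state_eq_estimate_add_error ht K)
    (by simpa only [hxg] using hmin _ (estimatorGain S t K).measurable)
  simpa only [hxg] using hae

/-- The covariance of the error of the Kalman estimate is the covariance of the regression error
under the law of the noise, which is the same for all runs. -/
theorem IsKalmanEstimate.covMat_error_eq {xhat : Ω → EuclideanSpace ℝ (Fin n)}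
    (hx : IsKalmanEstimate τ t μ xhat) (h : τ.IsCausalRun 𝓖 S T μ) (ht : t ≤ T)
    {K : EuclideanSpace ℝ (Fin (t + 1) × Fin p) →L[ℝ] EuclideanSpace ℝ (Fin n)}
    (hK : IndepFun (estimatorError S T t K) (freeOutputs S T t) (noiseLaw S T)) :
    covMat (fun ω => τ.x t ω - xhat ω) μ = covMat (estimatorError S T t K) (noiseLaw S T) := by
  rw [covMat_congr (Y := fun ω => estimatorError S T t K (τ.noiseVec T ω))
    ((hx.ae_eq h ht hK).mono fun ω hω => by
      simp only [hω, h.follows.state_eq_estimate_add_error ht K ω, add_sub_cancel_left]),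
    ← h.gaussian.map_noiseVec h.indep]
  ext i j
  have hi : ∀ i : Fin n, Measurable fun ξ => estimatorError S T t K ξ i := fun i =>
    (EuclideanSpace.proj (𝕜 := ℝ) i ∘L estimatorError S T t K).measurable
  simp only [covMat, Matrix.of_apply]
  rw [covariance_map_fun (hi i).aestronglyMeasurable (hi j).aestronglyMeasurable
    h.gaussian.measurable_noiseVec.aemeasurable]

end KalmanEstimate

/-- The data matrix of the inputs and outputs has the regressors as columns. -/
theorem fromRows_inputData_outputData (D : ℕ → Trajectory n m p Ω) (N t : ℕ) (ω : Ω) :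
    Matrix.fromRows (inputData D N t ω) (outputData D N t ω)
      = columns fun i : Fin N => (D i).past t ω := by
  ext (k | k) i <;> rfl

theorem stateData_eq (D : ℕ → Trajectory n m p Ω) (hD : ∀ i, (D i).Follows S T) (ht : t ≤ T)
    (K : EuclideanSpace ℝ (Fin (t + 1) × Fin p) →L[ℝ] EuclideanSpace ℝ (Fin n)) (N : ℕ) (ω : Ω) :
    stateData D N t ω
      = (Matrix.toEuclideanLin.symm (estimatorGain S t K : _ →ₗ[ℝ] _) :
            Matrix (Fin n) (PastIndex m p t) ℝ)
          * columns (fun i : Fin N => (D i).past t ω)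
        + columns fun i : Fin N => estimatorError S T t K ((D i).noiseVec T ω) := by
  ext a i
  have h1 := congrArg (fun v => v.ofLp a) ((hD i).state_eq_estimate_add_error ht K ω)
  have h2 := congrArg (fun v => v.ofLp a) (congrArg (fun f => f ((D i).past t ω))
    (Matrix.toEuclideanLin.apply_symm_apply (estimatorGain S t K : _ →ₗ[ℝ] _)))
  simp only [PiLp.add_apply] at h1
  rw [Matrix.add_apply]
  refine h1.trans ?_
  congr 1
  exact h2.symm

/-- Whenever the regressors have full row rank, the data-driven estimate differs from the linear
estimate by the propagated errors of the experiments. -/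
theorem dataGain_apply_eq (D : ℕ → Trajectory n m p Ω) (hD : ∀ i, (D i).Follows S T) (ht : t ≤ T)
    (K : EuclideanSpace ℝ (Fin (t + 1) × Fin p) →L[ℝ] EuclideanSpace ℝ (Fin n)) (N : ℕ) (ω : Ω)
    (hZ : columns (fun i : Fin N => (D i).past t ω)
      * pinv (columns fun i : Fin N => (D i).past t ω) = 1)
    (z : EuclideanSpace ℝ (PastIndex m p t)) :
    (dataGain D N t ω).toEuclideanLin z = estimatorGain S t K z
      + ((columns fun i : Fin N => estimatorError S T t K ((D i).noiseVec T ω))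
        * pinv (columns fun i : Fin N => (D i).past t ω)).toEuclideanLin z := by
  rw [dataGain, fromRows_inputData_outputData, stateData_eq D hD ht K, Matrix.add_mul,
    Matrix.mul_assoc, hZ, Matrix.mul_one, map_add, LinearMap.add_apply,
    LinearEquiv.apply_symm_apply]
  rfl

section Law

variable [MeasurableSpace Ω] {μ : Measure Ω} [IsProbabilityMeasure μ]
  {D : ℕ → Trajectory n m p Ω} {Su : Matrix (Fin m) (Fin m) ℝ}

open scoped Matrix MatrixOrder Matrix.Norms.L2Operator

theorem IsDataset.hasSubgaussianMGF_error (h : IsDataset D S Su T μ)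
    (K : EuclideanSpace ℝ (Fin (t + 1) × Fin p) →L[ℝ] EuclideanSpace ℝ (Fin n)) (i : ℕ)
    {a : EuclideanSpace ℝ (Fin n)} (ha : ‖a‖ = 1) :
    HasSubgaussianMGF (fun ω => inner ℝ a (estimatorError S T t K ((D i).noiseVec T ω)))
      ‖covMat (estimatorError S T t K) (noiseLaw S T)‖₊ μ := by
  let ℓ : NoiseVec n p T →L[ℝ] ℝ := innerSL ℝ a ∘L estimatorError S T t K
  have hlaw := (h.isCausalRun i).gaussian.map_noiseVec (h.isCausalRun i).indep
  have hn := (h.isCausalRun i).gaussian.measurable_noiseVec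
  have hv : variance (fun ω => ℓ ((D i).noiseVec T ω)) μ = variance ℓ (noiseLaw S T) := by
    rw [← hlaw, variance_map ℓ.continuous.aemeasurable hn.aemeasurable]
    rfl
  refine hasSubgaussianMGF_of_hasGaussianLaw
    ((h.hasGaussianLaw_sourceVec i).map_fun (ℓ ∘L noisePart n m p T))
    (h.integral_comp_sourceVec i (ℓ ∘L noisePart n m p T)) ?_
  refine hv.le.trans ?_
  exact (variance_inner_eq (memLp_estimatorError K) a).le.trans (dotProduct_mulVec_le_norm _ ha)

/-- The regressors have the standard normal law after whitening with the square root of their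
covariance. -/
theorem IsDataset.map_inner_inv_sqrt_past (h : IsDataset D S Su T μ) (hSu : Su.PosDef) (ht : t ≤ T)
    {v : EuclideanSpace ℝ (PastIndex m p t)} (hv : ‖v‖ = 1) (i : ℕ) :
    μ.map (fun ω => inner ℝ
        ((CFC.sqrt (covMat (fun ω => (D 0).past t ω) μ))⁻¹.toEuclideanLin v) ((D i).past t ω))
      = gaussianReal 0 1 := by
  set b := (CFC.sqrt (covMat (fun ω => (D 0).past t ω) μ))⁻¹.toEuclideanLin v with hb
  have hvar : variance (fun ω => inner ℝ b ((D i).past t ω)) μ = 1 := by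
    rw [h.variance_inner_past ht i b, ← h.variance_inner_past ht 0 b,
      variance_inner_eq (h.memLp_past ht 0), hb,
      dotProduct_mulVec_inv_sqrt (h.posDef_covMat_past hSu ht 0), hv, one_pow]
  have hlaw : HasGaussianLaw (fun ω => inner ℝ b ((D i).past t ω)) μ := by
    simp only [(h.follows i).past_eq ht]
    exact (h.hasGaussianLaw_sourceVec i).map_fun (innerSL ℝ b ∘L pastMap S T t)
  have hint : ∫ ω, inner ℝ b ((D i).past t ω) ∂μ = 0 := by
    simp only [(h.follows i).past_eq ht]
    exact h.integral_comp_sourceVec i (innerSL ℝ b ∘L pastMap S T t)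
  rw [hlaw.map_eq_gaussianReal, hint, hvar, Real.toNNReal_one]

theorem IsDataset.measure_error_mul_pinv_le (h : IsDataset D S Su T μ) (hSu : Su.PosDef)
    (ht : t ≤ T) (hn : 1 ≤ n)
    {K : EuclideanSpace ℝ (Fin (t + 1) × Fin p) →L[ℝ] EuclideanSpace ℝ (Fin n)}
    (hK : IndepFun (estimatorError S T t K) (freeOutputs S T t) (noiseLaw S T))
    {δ : ℝ} (hδ : 0 < δ) (hδ' : δ ≤ 1 / 2) {N : ℕ}
    (hN : 8 * (((m : ℝ) + p) * t + p) + 16 * Real.log (1 / δ) ≤ N) :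
    μ {ω | ¬ (columns (fun i : Fin N => (D i).past t ω)
          * pinv (columns fun i : Fin N => (D i).past t ω) = 1 ∧
        ∀ z, ‖((columns fun i : Fin N => estimatorError S T t K ((D i).noiseVec T ω))
            * pinv (columns fun i : Fin N => (D i).past t ω)).toEuclideanLin z‖
          ≤ kalmanConst n m p t δ (covMat (fun ω => (D 0).past t ω) μ)
            (covMat (estimatorError S T t K) (noiseLaw S T)) / √N * ‖z‖)}
      ≤ ENNReal.ofReal (2 * δ) := by
  set SZ := covMat (fun ω => (D 0).past t ω) μ with hSZ
  set Se := covMat (estimatorError S T t K) (noiseLaw S T) with hSe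
  have hcard : (Fintype.card (PastIndex m p t) : ℝ) = ((m : ℝ) + p) * t + p := by
    simp only [Fintype.card_sum, Fintype.card_prod, Fintype.card_fin]
    push_cast
    ring
  have hsrc : iIndepFun (fun (i : Fin N) => (D i).sourceVec T) μ :=
    h.iIndepFun_sourceVec.precomp Fin.val_injective
  have hpast : ∀ i, (D i).past t = fun ω => pastMap S T t ((D i).sourceVec T ω) := fun i =>
    funext fun ω => (h.follows i).past_eq ht ω
  have key := measure_noise_mul_pinv_le (μ := μ) (N := N)
    (Z := fun i => (D i).past t) (E := fun i ω => estimatorError S T t K ((D i).noiseVec T ω))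
    (R := (CFC.sqrt SZ)⁻¹) (σ := NNReal.sqrt ‖Se‖₊) (δ := δ)
    (fun i => (h.isCausalRun i).measurable_past' ht)
    (fun i => (estimatorError S T t K).measurable.comp
      (h.isCausalRun i).gaussian.measurable_noiseVec)
    (by
      simp only [hpast]
      exact hsrc.comp (fun _ => pastMap S T t) fun _ => (pastMap S T t).measurable)
    (hsrc.comp (fun _ => estimatorError S T t K ∘L noisePart n m p T)
      fun _ => (estimatorError S T t K ∘L noisePart n m p T).measurable)
    (h.indepFun_past_error ht N hK) (inv_sqrt_transpose SZ)
    (by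
      have hu := isUnit_det_sqrt (h.posDef_covMat_past hSu ht 0)
      rw [Matrix.det_nonsing_inv]
      exact hu.ringInverse)
    (fun v hv i => h.map_inner_inv_sqrt_past hSu ht hv i)
    (fun i a ha => by
      rw [NNReal.sq_sqrt]
      exact h.hasSubgaussianMGF_error K i ha)
    hδ hδ' (by rw [Fintype.card_fin]; omega) (by rw [hcard]; exact hN)
  have hconst : 16 * ‖(CFC.sqrt SZ)⁻¹‖ * (NNReal.sqrt ‖Se‖₊ : ℝ)
      * √((Fintype.card (PastIndex m p t) + Fintype.card (Fin n)) * Real.log (9 / δ))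
      = kalmanConst n m p t δ SZ Se := by
    rw [kalmanConst, hcard, Fintype.card_fin, Real.coe_sqrt, coe_nnnorm,
      show ((m : ℝ) + p) * t + p + n = (m + p) * t + n + p by ring]
  rw [hconst] at key
  exact key

theorem kalmanConst_nonneg (δ : ℝ) (SZ : Matrix (PastIndex m p t) (PastIndex m p t) ℝ)
    (Se : Matrix (Fin n) (Fin n) ℝ) : 0 ≤ kalmanConst n m p t δ SZ Se := by
  unfold kalmanConst
  positivity

end Law

end Estimate

end DataKF

theorem theorem2 {n m p : ℕ} (S : DataKF.LinearSystem n m p)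
    (Su : Matrix (Fin m) (Fin m) ℝ) (hSu : Su.PosDef) (T : ℕ)
    {Ω : Type*} (𝓖 : MeasurableSpace Ω) [MeasurableSpace Ω] (μ : Measure Ω) [IsProbabilityMeasure μ]
    (D : ℕ → DataKF.Trajectory n m p Ω) (hD : DataKF.IsDataset D S Su T μ)
    (τ : DataKF.Trajectory n m p Ω) (hτ : DataKF.Trajectory.IsCausalRun 𝓖 τ S T μ)
    (t : ℕ) (ht : t ≤ T)
    (xKF : Ω → EuclideanSpace ℝ (Fin n)) (hKF : DataKF.IsKalmanEstimate τ t μ xKF)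
    (δ : ℝ) (hδ : 0 < δ) (hδ' : δ ≤ 1 / 2) :
    ∀ N : ℕ, 8 * (((m : ℝ) + p) * t + p) + 16 * Real.log (1 / δ) ≤ N →
      ENNReal.ofReal (1 - 2 * δ) ≤
        μ {ω | ‖xKF ω - (DataKF.dataGain D N t ω).toEuclideanLin (τ.past t ω)‖ ≤
          DataKF.kalmanConst n m p t δ
              (DataKF.covMat (fun ω' => (D 0).past t ω') μ)
              (DataKF.covMat (fun ω' => τ.x t ω' - xKF ω') μ) / √(N : ℝ)
            * ‖τ.past t ω‖} := by
  intro N hN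
  obtain ⟨K, hK⟩ := DataKF.exists_regression_gain S T t
  rw [hKF.covMat_error_eq hτ ht hK]
  set c := DataKF.kalmanConst n m p t δ (DataKF.covMat (fun ω' => (D 0).past t ω') μ)
    (DataKF.covMat (DataKF.estimatorError S T t K) (DataKF.noiseLaw S T)) with hc
  set good := {ω | ‖xKF ω - (DataKF.dataGain D N t ω).toEuclideanLin (τ.past t ω)‖
    ≤ c / √(N : ℝ) * ‖τ.past t ω‖} with hgood
  -- it suffices to bound the outer measure of the complement
  suffices hbad : μ goodᶜ ≤ ENNReal.ofReal (2 * δ) by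
    rw [ENNReal.ofReal_sub _ (by positivity), ENNReal.ofReal_one, tsub_le_iff_right]
    calc (1 : ENNReal) = μ (good ∪ goodᶜ) := by rw [Set.union_compl_self, measure_univ]
      _ ≤ μ good + μ goodᶜ := measure_union_le _ _
      _ ≤ μ good + ENNReal.ofReal (2 * δ) := by gcongr
  rcases Nat.eq_zero_or_pos n with rfl | hn
  · -- without a state there is no error
    have : goodᶜ = ∅ := by
      rw [Set.compl_empty_iff, Set.eq_univ_iff_forall]
      intro ω
      have h0 : xKF ω - (DataKF.dataGain D N t ω).toEuclideanLin (τ.past t ω) = 0 :=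
        Subsingleton.elim _ _
      have hc0 : 0 ≤ c := DataKF.kalmanConst_nonneg _ _ _
      simp only [hgood, Set.mem_ofPred_eq, h0, norm_zero]
      positivity
    rw [this, measure_empty]
    exact zero_le
  · refine le_trans (measure_mono_ae ?_) (hD.measure_error_mul_pinv_le hSu ht hn hK hδ hδ' hN)
    filter_upwards [hKF.ae_eq hτ ht hK] with ω hω hmem hev
    refine hmem ?_
    change ‖_‖ ≤ _
    rw [hω, DataKF.dataGain_apply_eq D hD.follows ht K N ω hev.1, sub_add_cancel_left,
      norm_neg]
    exact hev.2 _
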